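/- Let $r>1$ be an irrational real number and let $P_r=\{\lfloor nr\rfloor : n\in\mathbb Z\setminus\{0\}\}$. Let $L_P=\{+,-,0,1,P\}$ with $P$ a unary predicate symbol, and let $L_\pm$ be the extension of $L_P$ by unary predicate symbols $D_{m,+}$ and $D_{m,-}$ for $m\ge 1$. Every $L_P$-structure $\mathcal M$ is regarded as an $L_\pm$-structure by interpreting $D_{m,+}(x)$ as $\exists y\,(x=my\wedge y\in P)$ and $D_{m,-}(x)$ as $\exists y\,(x=my\wedge y\notin P)$. Then one can choose, for all $n$, all $\vec k=(k_1,\dots,k_n)\in\mathbb Z^n$ and all $I\subseteq\{1,\dots,n\}$, a quantifier-free $L_\pm$-formula $\psi_{\vec k,I}(x_1,\dots,x_n)$ such that the sentence $$(\star)_{\vec k,I}\qquad \forall x_1\cdots\forall x_n\Big(\exists y\Big(\bigwedge_{i\in I}x_i+k_iy\in P\ \wedge\bigwedge_{j\notin I}x_j+k_jy\notin P\Big)\leftrightarrow\psi_{\vec k,I}(x_1,\dots,x_n)\Big)$$ holds in $(\mathbb Z,+,-,0,1,P_r)$ for all $\vec k$ and $I$, and such that the following two statements are true. (a) An $L_P$-structure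 $\mathcal M=(M,+,-,0,1,P^{\mathcal M})$ is elementarily equivalent to $(\mathbb Z,+,-,0,1,P_r)$ if and only if 1. $(M,+,-,0,1)\equiv(\mathbb Z,+,-,0,1)$; 2. for all $n$, all $\vec k\in\mathbb Z^n$ and all $I\subseteq\{1,\dots,n\}$, the sentence $(\star)_{\vec k,I}$ holds in $\mathcal M$; 3. for every $k\in\mathbb Z$: $k\in P_r$ if and only if $k\in P^{\mathcal M}$, where $k$ stands in $\mathcal M$ for the value of the term $k\cdot 1$. (b) Let $T_r^*$ be the $L_\pm$-theory consisting of the theory of $(\mathbb Z,+,-,0,1)$, all the sentences $(\star)_{\vec k,I}$, the sentences $\forall x\,(D_{m,+}(x)\leftrightarrow\exists y(x=my\wedge y\in P))$ and $\forall x\,(D_{m,-}(x)\leftrightarrow\exists y(x=my\wedge y\notin P))$ for $m\ge 1$, and, for each integer $k>0$, the sentence $k\in P$ if $k\in P_r$ and the sentence $k\notin P$ if $k\notin P_r$. Then $T_r^*$ is complete. -/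

import Mathlib

open FirstOrder FirstOrder.Language

namespace Beatty

/-- The set `P_r` of all integers `⌊n r⌋` with `n` a nonzero integer. -/
def beattySet (r : ℝ) : Set ℤ :=
  {k | ∃ n : ℤ, n ≠ 0 ∧ ⌊(n : ℝ) * r⌋ = k}

/-! ### The three languages -/

/-- The function symbols `0, 1, -, +`. -/
inductive GroupFunc : ℕ → Type
  | zero : GroupFunc 0
  | one : GroupFunc 0
  | neg : GroupFunc 1
  | add : GroupFunc 2

/-- The single unary predicate symbol `P`. -/
inductive PredRel : ℕ → Type
  | P : PredRel 1

/-- The unary predicate symbols `P`, `D_{m,+}` and `D_{m,-}` for `m ≥ 1`. -/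
inductive DivRel : ℕ → Type
  | P : DivRel 1
  | Dplus (m : ℕ+) : DivRel 1
  | Dminus (m : ℕ+) : DivRel 1

/-- The language `{+, -, 0, 1}` of abelian groups with a distinguished element. -/
def LGrp : Language := ⟨GroupFunc, fun _ => Empty⟩

/-- The language `L_P = {+, -, 0, 1, P}`. -/
def LP : Language := ⟨GroupFunc, PredRel⟩

/-- The language `L_±`, that is, `L_P` together with all the `D_{m,+}` and `D_{m,-}`. -/
def LPM : Language := ⟨GroupFunc, DivRel⟩

/-- The inclusion of `{+, -, 0, 1}` in `L_P`. -/
def grpToLP : LGrp →ᴸ LP where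
  onFunction := fun _ f => f
  onRelation := fun _ R => Empty.elim R

/-- The inclusion of `L_P` in `L_±`. -/
def lpToLPM : LP →ᴸ LPM where
  onFunction := fun _ f => f
  onRelation := fun _ R => match R with
    | PredRel.P => DivRel.P

/-! ### The standard structures -/

/-- Interpretation of `0, 1, -, +` in the integers. -/
def intFun : {n : ℕ} → GroupFunc n → (Fin n → ℤ) → ℤ
  | _, GroupFunc.zero, _ => 0
  | _, GroupFunc.one, _ => 1
  | _, GroupFunc.neg, v => -(v 0)
  | _, GroupFunc.add, v => v 0 + v 1

/-- The structure `(ℤ, +, -, 0, 1)`. -/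
instance intGrpStructure : LGrp.Structure ℤ where
  funMap := fun f v => intFun f v
  RelMap := fun R _ => Empty.elim R

/-- The underlying set of the structure `(ℤ, +, -, 0, 1, P_r)`; a copy of `ℤ`. -/
def BeattyInt (_r : ℝ) : Type := ℤ

/-- The structure `(ℤ, +, -, 0, 1, P_r)`. -/
instance beattyStructure (r : ℝ) : LP.Structure (BeattyInt r) where
  funMap := fun f v => intFun f v
  RelMap := fun R v => match R, v with
    | PredRel.P, v => (v 0 : ℤ) ∈ beattySet r

/-! ### Terms and formulas of `L_P` -/

section Terms

variable {α : Type}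

/-- The term `0`. -/
def zeroT : LP.Term α := Term.func GroupFunc.zero ![]

/-- The term `1`. -/
def oneT : LP.Term α := Term.func GroupFunc.one ![]

/-- The term `-t`. -/
def negT (t : LP.Term α) : LP.Term α := Term.func GroupFunc.neg ![t]

/-- The term `s + t`. -/
def addT (s t : LP.Term α) : LP.Term α := Term.func GroupFunc.add ![s, t]

/-- The term `t + ⋯ + t` with `m` summands. -/
def natMulT : ℕ → LP.Term α → LP.Term α
  | 0, _ => zeroT
  | m + 1, t => addT (natMulT m t) t

/-- The term `k t` for an integer `k`. -/
def intMulT : ℤ → LP.Term α → LP.Term α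
  | Int.ofNat m, t => natMulT m t
  | Int.negSucc m, t => negT (natMulT (m + 1) t)

/-- The formula `t ∈ P`. -/
def inP {n : ℕ} (t : LP.Term (α ⊕ Fin n)) : LP.BoundedFormula α n :=
  BoundedFormula.rel (PredRel.P : LP.Relations 1) ![t]

end Terms

/-- The sentence `k ∈ P` for an integer `k`, where `k` stands for the term `k 1`. -/
def numeralInP (k : ℤ) : LP.Sentence := inP (intMulT k oneT)

open Classical in
/-- The formula `φ_{k,I}(x_1, …, x_n)`, that is,
`∃ y (⋀_{i ∈ I} x_i + k_i y ∈ P ∧ ⋀_{j ∉ I} x_j + k_j y ∉ P)`.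
The variables `x_1, …, x_n, y` are the bound-level variables `0, …, n - 1, n`. -/
noncomputable def patternFormula {n : ℕ} (k : Fin n → ℤ) (I : Finset (Fin n)) :
    LP.BoundedFormula Empty n :=
  (BoundedFormula.iInf fun i : Fin n =>
    if i ∈ I then
      inP (addT (Term.var (Sum.inr i.castSucc)) (intMulT (k i) (Term.var (Sum.inr (Fin.last n)))))
    else
      (inP (addT (Term.var (Sum.inr i.castSucc))
        (intMulT (k i) (Term.var (Sum.inr (Fin.last n)))))).not).ex

/-- The formula `∃ y (x = m y ∧ y ∈ P)`. -/
def divPlusFormula (m : ℕ+) : LP.BoundedFormula Empty 1 :=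
  ((Term.var (Sum.inr 0)).bdEqual (natMulT m (Term.var (Sum.inr 1))) ⊓
    inP (Term.var (Sum.inr (1 : Fin 2)))).ex

/-- The formula `∃ y (x = m y ∧ y ∉ P)`. -/
def divMinusFormula (m : ℕ+) : LP.BoundedFormula Empty 1 :=
  ((Term.var (Sum.inr 0)).bdEqual (natMulT m (Term.var (Sum.inr 1))) ⊓
    (inP (Term.var (Sum.inr (1 : Fin 2)))).not).ex

/-! ### Expansion by definitions to `L_±`, and the axioms -/

/-- The expansion of an `L_P`-structure to an `L_±`-structure, in which `D_{m,+}` is the set of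
all `m y` with `y ∈ P`, and `D_{m,-}` the set of all `m y` with `y ∉ P`. -/
@[reducible]
def divExpansion (M : Type*) [LP.Structure M] : LPM.Structure M where
  funMap := fun f v => Structure.funMap (L := LP) f v
  RelMap := fun R v => match R, v with
    | DivRel.P, v => Structure.RelMap (L := LP) PredRel.P v
    | DivRel.Dplus m, v => (divPlusFormula m).Realize default v
    | DivRel.Dminus m, v => (divMinusFormula m).Realize default v

/-- An `L_±`-sentence, evaluated in an `L_P`-structure through the expansion by definitions. -/
def Holds (M : Type*) [LP.Structure M] (σ : LPM.Sentence) : Prop :=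
  @Sentence.Realize LPM M (divExpansion M) σ

/-- The sentence `∀ x_1 ⋯ ∀ x_n (φ_{k,I}(x) ↔ ψ(x))`. -/
noncomputable def starSentence {n : ℕ} (k : Fin n → ℤ) (I : Finset (Fin n))
    (ψ : LPM.BoundedFormula Empty n) : LPM.Sentence :=
  ((lpToLPM.onBoundedFormula (patternFormula k I)).iff ψ).alls

/-- The formula `R(x)` for a unary predicate symbol `R` of `L_±`. -/
def atomX (R : DivRel 1) : LPM.BoundedFormula Empty 1 :=
  BoundedFormula.rel (R : LPM.Relations 1) ![Term.var (Sum.inr 0)]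

/-- A choice of an `L_±`-formula `ψ_{k,I}(x_1, …, x_n)` for all `n`, all `k ∈ ℤⁿ` and all
`I ⊆ {1, …, n}`. -/
abbrev FormulaFamily : Type :=
  (n : ℕ) → (Fin n → ℤ) → Finset (Fin n) → LPM.BoundedFormula Empty n

/-- The theory `T_r^*`: the theory of `(ℤ, +, -, 0, 1)`, the sentences
`∀ x (φ_{k,I}(x) ↔ ψ_{k,I}(x))`, the definitions of the `D_{m,+}` and `D_{m,-}`, and, for each
positive integer `k`, the sentence `k ∈ P` or its negation according to whether `k ∈ P_r`. -/
def TrStar (r : ℝ) (ψ : FormulaFamily) : LPM.Theory :=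
  (lpToLPM.comp grpToLP).onTheory (LGrp.completeTheory ℤ)
  ∪ {σ | ∃ (n : ℕ) (k : Fin n → ℤ) (I : Finset (Fin n)), σ = starSentence k I (ψ n k I)}
  ∪ {σ | ∃ m : ℕ+,
      σ = ((atomX (DivRel.Dplus m)).iff (lpToLPM.onBoundedFormula (divPlusFormula m))).alls}
  ∪ {σ | ∃ m : ℕ+,
      σ = ((atomX (DivRel.Dminus m)).iff (lpToLPM.onBoundedFormula (divMinusFormula m))).alls}
  ∪ {σ | ∃ k : ℤ, 0 < k ∧ k ∈ beattySet r ∧ σ = lpToLPM.onSentence (numeralInP k)}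
  ∪ {σ | ∃ k : ℤ, 0 < k ∧ k ∉ beattySet r ∧ σ = lpToLPM.onSentence (numeralInP k).not}

end Beatty

/-!
Write `α = 1 / r`. Then `P_r` consists of the integers `k` for which the fractional part of `k α`
lies in the open arc `(1 - α, 1)` of the circle `ℝ / ℤ`, or equivalently of the `k ≠ -1` with
`⌊(k + 1) α⌋ = ⌊k α⌋ + 1` (`IsBeatty`).

The formulas `ψ` are found in `ℤ`. A pattern of conditions `x i + k i y ∈ P` and `x j + k j y ∉ P`
prescribes a finite union of arcs for `y α`. By the symmetry of `P_r` about `-1/2` one may assume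
that all `k i` are non-negative, and some `k i` is positive unless `y` is irrelevant. Since the
multiples of `α` are dense, the pattern is solvable if some arc of solutions starts at one of
finitely many end points; otherwise all its solutions are isolated, and then satisfy
`x i + k i y = -1` for some `i` (`IsBeatty.exists_pattern_iff`). Whether all conditions hold
immediately to the right of an end point is a question about single integers `w` that are affine
in `x`: is the fractional part of `(w α + l) / k` at least `1 - α`? The answer is determined by `⌊w α⌋` modulo `k` and by
`⌊(w + k) α⌋ - ⌊w α⌋`, and both are quantifier-free definable from `P` and the `D_{m,±}`
(`IsBeatty.isQFD1_floor_emod`, `IsBeatty.isQFD1_floor_add`). No equality is needed, because `0` is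
the only `x` with `x ∉ P`, `-x ∉ P` and `x + j ∈ P`, for a fixed `j ∈ P` (`IsBeatty.eq_zero_iff`).

In this way almost all `ψ` are free of equality; they are handled as codes (`QFCode`). Three of
them are chosen differently (`starFamily`), so that the sentences `(⋆)` also express that `x ≠ 0`
if and only if `y ∈ P` and `x + y ∉ P` for some `y`, that `P` is symmetric about `-1/2`, and that
`0 ∉ P`. The last two facts recover membership in `P` of the integers `k ≤ 0` from that of the
integers `k > 0`, as is necessary for the completeness of `T_r^*`.

The sentences `(⋆)` and the theory of `(ℤ, +, -, 0, 1)` give quantifier elimination down to codes,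
uniformly in all models (`QFCode.eval_elim`, `eval_toCode`). Splitting the variables according to
their residues modulo a common modulus turns a code into a Boolean combination of conditions
`f ∈ P` with `f` affine. An existential quantifier in front of it becomes a disjunction of
patterns, to which `(⋆)` applies. Equality disappears, as `x = 0` means that there is no `y ∈ P` with
`x + y ∉ P`. In the end every sentence is equivalent to a code without variables, whose truth
depends only on which integers are in `P` (`QFCode.eval_closed_congr`). So any two structures that
satisfy the axioms are elementarily equivalent.
-/

namespace Beatty

/-! ### Affine forms and equality-free quantifier-free conditions -/

/-- Integral affine forms `a₁ x₁ + ⋯ + aₙ xₙ + b` in `n` variables, as pairs `(a, b)`. -/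
abbrev Form (n : ℕ) : Type := (Fin n → ℤ) × ℤ

section Abstract

variable {M : Type*} [AddCommGroup M]

/-- The value of an affine form at a point `x`, where the constant term is a multiple of `u`. -/
def evalForm {n : ℕ} (u : M) (x : Fin n → M) : Form n →+ M where
  toFun f := ∑ i, f.1 i • x i + f.2 • u
  map_zero' := by simp
  map_add' f g := by
    simp only [Prod.fst_add, Prod.snd_add, Pi.add_apply, add_smul, Finset.sum_add_distrib]
    abel

theorem evalForm_apply {n : ℕ} (u : M) (x : Fin n → M) (f : Form n) :
    evalForm u x f = ∑ i, f.1 i • x i + f.2 • u := rfl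

/-- The coordinate function `x i` as an affine form. -/
def coordForm {n : ℕ} (i : Fin n) : Form n := (Pi.single i 1, 0)

/-- The constant affine form `b`. -/
def constForm {n : ℕ} (b : ℤ) : Form n := (0, b)

@[simp]
theorem evalForm_coordForm {n : ℕ} (u : M) (x : Fin n → M) (i : Fin n) :
    evalForm u x (coordForm i) = x i := by
  simp [evalForm_apply, coordForm, Pi.single_apply, ite_smul]

@[simp]
theorem evalForm_constForm {n : ℕ} (u : M) (x : Fin n → M) (b : ℤ) :
    evalForm u x (constForm b) = b • u := by
  simp [evalForm_apply, constForm]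

/-- Substitution of the affine forms `g i` for the variables of `f`. -/
def substForm {n k : ℕ} (g : Fin n → Form k) (f : Form n) : Form k :=
  ∑ i, f.1 i • g i + f.2 • constForm 1

@[simp]
theorem evalForm_substForm {n k : ℕ} (u : M) (x : Fin k → M) (g : Fin n → Form k) (f : Form n) :
    evalForm u x (substForm g f) = evalForm u (fun i => evalForm u x (g i)) f := by
  simp only [substForm, map_add, map_sum, map_zsmul, evalForm_constForm, one_smul,
    evalForm_apply u (fun i => evalForm u x (g i))]

/-- The part of an affine form in `n + 1` variables that is free of the last variable. -/
def initForm {n : ℕ} (f : Form (n + 1)) : Form n := (fun i => f.1 i.castSucc, f.2)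

theorem evalForm_snoc {n : ℕ} (u : M) (x : Fin n → M) (y : M) (f : Form (n + 1)) :
    evalForm u (Fin.snoc x y : Fin (n + 1) → M) f =
      evalForm u x (initForm f) + f.1 (Fin.last n) • y := by
  simp only [evalForm_apply, initForm, Fin.sum_univ_castSucc, Fin.snoc_castSucc, Fin.snoc_last]
  abel

/-- The value of a form at `N x + d`, for a vector `d` of integers. -/
theorem evalForm_residue {n : ℕ} (u : M) (N : ℤ) (x : Fin n → M) (d : Fin n → ℤ) (f : Form n) :
    evalForm u (fun i => N • x i + d i • u) f =
      N • (∑ i, f.1 i • x i) + evalForm (1 : ℤ) d f • u := by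
  simp only [evalForm_apply, smul_add, Finset.sum_add_distrib, Finset.smul_sum, smul_eq_mul,
    mul_one, add_smul, Finset.sum_smul, mul_smul, add_assoc]
  congr 1
  exact Finset.sum_congr rfl fun i _ => smul_comm _ _ _

end Abstract

/-- Codes for the quantifier-free conditions on `n`-tuples that do not mention equality: Boolean
combinations of the atoms `D_{m,+}(f)` (for `s = true`) and `D_{m,-}(f)` (for `s = false`), with
`f` an affine form. Membership in `P` is the case `m = 1`. -/
inductive QFCode (n : ℕ) : Type
  | atom (m : ℕ+) (s : Bool) (f : Form n) : QFCode n
  | fls : QFCode n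
  | imp (p q : QFCode n) : QFCode n

namespace QFCode

section Eval

variable {M : Type*} [AddCommGroup M] {n k : ℕ}

/-- The truth of a coded condition at a tuple `x` of a group `M` with distinguished element `u`
and distinguished subset `P`. -/
def eval (u : M) (P : Set M) (x : Fin n → M) : QFCode n → Prop
  | atom m s f => ∃ y, evalForm u x f = (m : ℤ) • y ∧ (y ∈ P ↔ s = true)
  | fls => False
  | imp p q => p.eval u P x → q.eval u P x

/-- Negation of codes. -/
def not (p : QFCode n) : QFCode n := imp p fls

/-- Conjunction of codes. -/
def and (p q : QFCode n) : QFCode n := (imp p q.not).not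

/-- Disjunction of codes. -/
def or (p q : QFCode n) : QFCode n := imp p.not q

/-- Membership of an affine form in `P`, as a code. -/
def mem (f : Form n) : QFCode n := atom 1 true f

/-- The disjunction of a finite family of codes. -/
noncomputable def disj {ι : Type*} (s : Finset ι) (p : ι → QFCode n) : QFCode n :=
  s.toList.foldr (fun i q => (p i).or q) fls

/-- The code of the condition that `x i ≡ d i` modulo `N`, for all `i`. -/
noncomputable def residue (N : ℕ+) (d : Fin n → ℤ) : QFCode n :=
  (disj Finset.univ fun i : Fin n =>
    ((atom N true (coordForm i - constForm (d i))).or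
      (atom N false (coordForm i - constForm (d i)))).not).not

/-- Substitution of affine forms for the variables of a code. -/
def subst (g : Fin n → Form k) : QFCode n → QFCode k
  | atom m s f => atom m s (substForm g f)
  | fls => fls
  | imp p q => imp (p.subst g) (q.subst g)

/-- The code of the condition on `N x + d` which the given code expresses on `x`. -/
def div (N : ℕ+) (d : Fin n → ℤ) : QFCode n → QFCode n
  | atom m s f => atom (m * N) s (f.1, N * f.2 - ∑ i, f.1 i * d i)
  | fls => fls
  | imp p q => imp (p.div N d) (q.div N d)

variable (u : M) (P : Set M) (x : Fin n → M)

@[simp]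
theorem eval_not (p : QFCode n) : p.not.eval u P x ↔ ¬ p.eval u P x := Iff.rfl

@[simp]
theorem eval_and (p q : QFCode n) : (p.and q).eval u P x ↔ p.eval u P x ∧ q.eval u P x := by
  simp [and, eval]

@[simp]
theorem eval_or (p q : QFCode n) : (p.or q).eval u P x ↔ p.eval u P x ∨ q.eval u P x := by
  simp [or, eval, or_iff_not_imp_left]

@[simp]
theorem eval_mem (f : Form n) : (mem f).eval u P x ↔ evalForm u x f ∈ P := by
  simp [mem, eval]

@[simp]
theorem eval_disj {ι : Type*} (s : Finset ι) (p : ι → QFCode n) :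
    (disj s p).eval u P x ↔ ∃ i ∈ s, (p i).eval u P x := by
  have h : ∀ l : List ι, (l.foldr (fun i q => (p i).or q) fls).eval u P x ↔
      ∃ i ∈ l, (p i).eval u P x := by
    intro l
    induction l with
    | nil => simp [eval]
    | cons a l ih => simp [ih]
  simp [disj, h]

theorem eval_residue (N : ℕ+) (d : Fin n → ℤ) :
    (residue N d).eval u P x ↔ ∃ z : Fin n → M, x = fun i => (N : ℤ) • z i + d i • u := by
  have h : ∀ i, ((atom N true (coordForm i - constForm (d i))).or
      (atom N false (coordForm i - constForm (d i)))).eval u P x ↔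
        ∃ z, x i = (N : ℤ) • z + d i • u := by
    intro i
    simp only [eval_or, eval, map_sub, evalForm_coordForm, evalForm_constForm, iff_true,
      Bool.false_eq_true, iff_false, sub_eq_iff_eq_add]
    constructor
    · rintro (⟨y, h, -⟩ | ⟨y, h, -⟩) <;> exact ⟨y, h⟩
    · rintro ⟨y, h⟩
      by_cases hy : y ∈ P
      · exact Or.inl ⟨y, h, hy⟩
      · exact Or.inr ⟨y, h, hy⟩
  simp only [residue, eval_not, eval_disj, Finset.mem_univ, true_and, h, funext_iff]
  push Not
  exact Classical.skolem

@[simp]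
theorem eval_subst (g : Fin n → Form k) (z : Fin k → M) (p : QFCode n) :
    (p.subst g).eval u P z ↔ p.eval u P fun i => evalForm u z (g i) := by
  induction p with
  | atom m s f => simp [subst, eval]
  | fls => rfl
  | imp p q hp hq => simp [subst, eval, hp, hq]

end Eval

end QFCode

/-! ### Groups that resemble the integers -/

/-- The first-order properties of `(ℤ, +, 1)` that quantifier elimination relies on: there is no
torsion, and every element has exactly one residue in `{0, …, m - 1}` modulo `m`, for `m ≥ 1`. -/
structure IsIntLike {M : Type*} [AddCommGroup M] (u : M) : Prop where
  torsion_free : ∀ m : ℕ+, ∀ x : M, (m : ℤ) • x = 0 → x = 0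
  exists_residue : ∀ (m : ℕ+) (x : M), ∃ (c : Fin m) (y : M), x = (m : ℤ) • y + (c : ℤ) • u
  dvd_of_smul : ∀ (m : ℕ+) (c : ℤ) (y : M), c • u = (m : ℤ) • y → (m : ℤ) ∣ c

theorem IsIntLike.smul_cancel {M : Type*} [AddCommGroup M] {u : M} (h : IsIntLike u) (m : ℕ+)
    {x y : M} (hxy : (m : ℤ) • x = (m : ℤ) • y) : x = y := by
  rw [← sub_eq_zero]
  exact h.torsion_free m _ (by rw [smul_sub, hxy, sub_self])

theorem isIntLike_int : IsIntLike (1 : ℤ) where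
  torsion_free m x h := by
    simpa using h
  exists_residue m x := by
    have hm : (0 : ℤ) < (m : ℕ) := by exact_mod_cast m.pos
    have h0 := Int.emod_nonneg x hm.ne'
    have h1 := Int.emod_lt_of_pos x hm
    refine ⟨⟨(x % (m : ℕ)).toNat, by omega⟩, x / (m : ℕ), ?_⟩
    have := Int.mul_ediv_add_emod x (m : ℕ)
    simp only [smul_eq_mul, mul_one, Int.toNat_of_nonneg h0]
    exact this.symm
  dvd_of_smul m c y h := ⟨y, by simpa using h⟩

namespace QFCode

variable {M : Type*} [AddCommGroup M] {u : M} {n : ℕ}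

theorem eval_div (hu : IsIntLike u) (P : Set M) (N : ℕ+) (d : Fin n → ℤ) (z : Fin n → M)
    (p : QFCode n) :
    (p.div N d).eval u P (fun i => (N : ℤ) • z i + d i • u) ↔ p.eval u P z := by
  induction p with
  | atom m s f =>
    simp only [div, eval]
    refine exists_congr fun y => and_congr_left fun _ => ?_
    have h : evalForm u (fun i => (N : ℤ) • z i + d i • u) (f.1, N * f.2 - ∑ i, f.1 i * d i) =
        (N : ℤ) • evalForm u z f := by
      rw [evalForm_residue, evalForm_apply, evalForm_apply, smul_add, smul_smul]
      simp
    rw [h, PNat.mul_coe, Nat.cast_mul, mul_comm, mul_smul]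
    exact ⟨fun h => hu.smul_cancel N h, fun h => by rw [h]⟩
  | fls => rfl
  | imp p q hp hq => simp only [div, eval, hp, hq]

theorem eval_residue_and_div (hu : IsIntLike u) (P : Set M) (N : ℕ+) (d : Fin n → ℤ)
    (x : Fin n → M) (p : QFCode n) :
    ((residue N d).and (p.div N d)).eval u P x ↔
      ∃ z : Fin n → M, x = (fun i => (N : ℤ) • z i + d i • u) ∧ p.eval u P z := by
  rw [eval_and, eval_residue]
  constructor
  · rintro ⟨⟨z, rfl⟩, h⟩
    exact ⟨z, rfl, (eval_div hu P N d z p).1 h⟩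
  · rintro ⟨z, rfl, h⟩
    exact ⟨⟨z, rfl⟩, (eval_div hu P N d z p).2 h⟩

/-! ### Elimination of one quantifier -/

/-- A common multiple of all the moduli `m` that occur in a code. -/
def modulus : QFCode n → ℕ+
  | atom m _ _ => m
  | fls => 1
  | imp p q => p.modulus * q.modulus

/-- For `m ∣ N` and a form `f` whose value at the integer vector `d` is divisible by `m`, the form
whose value at `z` is the `m`-th part of the value of `f` at `N z + d`. -/
def quotForm (N m : ℤ) (d : Fin n → ℤ) (f : Form n) : Form n :=
  ((N / m) • f.1, evalForm (1 : ℤ) d f / m)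

theorem smul_evalForm_quotForm (z : Fin n → M) {N m : ℤ} (d : Fin n → ℤ) (f : Form n)
    (hm : m ∣ N) (hd : m ∣ evalForm (1 : ℤ) d f) :
    m • evalForm u z (quotForm N m d f) = evalForm u (fun i => N • z i + d i • u) f := by
  rw [evalForm_residue]
  simp only [evalForm_apply u z, quotForm, smul_add, smul_smul, Finset.smul_sum, Pi.smul_apply,
    smul_eq_mul, Int.mul_ediv_cancel' hd, ← mul_assoc, Int.mul_ediv_cancel' hm]

/-- The forms whose membership in `P`, at a point `z`, decides the truth of the given code at
`N z + d`. -/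
def quotForms (N : ℕ+) (d : Fin n → ℤ) : QFCode n → List (Form n)
  | atom m _ f => [quotForm N m d f]
  | fls => []
  | imp p q => p.quotForms N d ++ q.quotForms N d

/-- The truth of the given code at `N z + d`, computed from the set `I` of those affine forms whose
value at `z` is in `P`. -/
def truth (N : ℕ+) (d : Fin n → ℤ) (I : Set (Form n)) : QFCode n → Prop
  | atom m s f => (m : ℤ) ∣ evalForm (1 : ℤ) d f ∧ (quotForm N m d f ∈ I ↔ s = true)
  | fls => False
  | imp p q => p.truth N d I → q.truth N d I

theorem eval_iff_truth (hu : IsIntLike u) (P : Set M) {N : ℕ+} (d : Fin n → ℤ) (I : Set (Form n))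
    (z : Fin n → M) (p : QFCode n) (hN : p.modulus ∣ N)
    (hI : ∀ f ∈ p.quotForms N d, evalForm u z f ∈ P ↔ f ∈ I) :
    p.eval u P (fun i => (N : ℤ) • z i + d i • u) ↔ p.truth N d I := by
  induction p with
  | atom m s f =>
    have hmN : (m : ℤ) ∣ N := by exact_mod_cast PNat.dvd_iff.1 hN
    simp only [eval, truth, ← hI _ (List.mem_singleton.2 rfl)]
    constructor
    · rintro ⟨y, h, hy⟩
      have hd : (m : ℤ) ∣ evalForm (1 : ℤ) d f := by
        obtain ⟨c, hc⟩ := hmN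
        refine hu.dvd_of_smul m _ (y - c • ∑ i, f.1 i • z i) ?_
        rw [smul_sub, ← h, evalForm_residue, smul_smul, ← hc]
        abel
      rw [← smul_evalForm_quotForm z d f hmN hd] at h
      exact ⟨hd, hu.smul_cancel m h ▸ hy⟩
    · rintro ⟨hd, hs⟩
      exact ⟨_, (smul_evalForm_quotForm z d f hmN hd).symm, hs⟩
  | fls => rfl
  | imp p q hp hq =>
    simp only [eval, truth]
    rw [hp ((Dvd.intro _ rfl).trans hN) fun f hf => hI f (List.mem_append_left _ hf),
      hq ((Dvd.intro_left _ rfl).trans hN) fun f hf => hI f (List.mem_append_right _ hf)]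

open Classical in
/-- The code of `∃ y, ⋀ (f (z, y) ∈ P ↔ f ∈ I)`, where `f` ranges over a list of forms, provided
that `ρ p k J` is the code of `∃ y, ⋀ (x i + k i y ∈ P ↔ i ∈ J)`. -/
noncomputable def patternCode (ρ : (p : ℕ) → (Fin p → ℤ) → Finset (Fin p) → QFCode p)
    (l : List (Form (n + 1))) (I : Set (Form (n + 1))) : QFCode n :=
  (ρ l.length (fun i => (l.get i).1 (Fin.last n))
    (Finset.univ.filter fun i => l.get i ∈ I)).subst fun i => initForm (l.get i)

/-- The forms which describe the truth of a code at `N z + d`, together with three copies of the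
last coordinate. The latter are harmless, and they give the list at least three entries, so that
only the sentences `(⋆)` with `n ≥ 3` are used, all of whose `ψ` are given by codes. -/
def paddedForms (N : ℕ+) (d : Fin (n + 1) → ℤ) (χ : QFCode (n + 1)) : List (Form (n + 1)) :=
  coordForm (Fin.last n) :: coordForm (Fin.last n) :: coordForm (Fin.last n) :: χ.quotForms N d

open Classical in
/-- The code that results from `χ` by eliminating an existential quantifier over the last variable,
where `ρ p k J` is the code of `∃ y, ⋀ (x i + k i y ∈ P ↔ i ∈ J)`. All variables are split according
to their residues modulo a common modulus, and then according to which of the relevant forms take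
values in `P`. -/
noncomputable def elim (ρ : (p : ℕ) → (Fin p → ℤ) → Finset (Fin p) → QFCode p)
    (χ : QFCode (n + 1)) : QFCode n :=
  disj (Finset.univ : Finset (Fin (n + 1) → Fin χ.modulus)) fun d =>
    (residue χ.modulus fun i => (d i.castSucc : ℤ)).and
      (div χ.modulus (fun i => (d i.castSucc : ℤ))
        (disj ((paddedForms χ.modulus (fun i => (d i : ℤ)) χ).toFinset.powerset.filter
            fun I : Finset (Form (n + 1)) => χ.truth χ.modulus (fun i => (d i : ℤ)) I)
          fun I : Finset (Form (n + 1)) =>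
            patternCode ρ (paddedForms χ.modulus (fun i => (d i : ℤ)) χ) I))

theorem eval_patternCode {ρ : (p : ℕ) → (Fin p → ℤ) → Finset (Fin p) → QFCode p} {P : Set M}
    (hρ : ∀ (p : ℕ), 3 ≤ p → ∀ (k : Fin p → ℤ) (J : Finset (Fin p)) (x : Fin p → M),
      (∃ y, ∀ i, x i + k i • y ∈ P ↔ i ∈ J) ↔ (ρ p k J).eval u P x)
    (l : List (Form (n + 1))) (hl : 3 ≤ l.length) (I : Set (Form (n + 1))) (z : Fin n → M) :
    (patternCode ρ l I).eval u P z ↔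
      ∃ y, ∀ f ∈ l, evalForm u (Fin.snoc z y : Fin (n + 1) → M) f ∈ P ↔ f ∈ I := by
  rw [patternCode, eval_subst, ← hρ _ hl]
  simp [evalForm_snoc, List.forall_mem_iff_get]

theorem eval_elim (hu : IsIntLike u) {P : Set M}
    {ρ : (p : ℕ) → (Fin p → ℤ) → Finset (Fin p) → QFCode p}
    (hρ : ∀ (p : ℕ), 3 ≤ p → ∀ (k : Fin p → ℤ) (J : Finset (Fin p)) (x : Fin p → M),
      (∃ y, ∀ i, x i + k i • y ∈ P ↔ i ∈ J) ↔ (ρ p k J).eval u P x)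
    (χ : QFCode (n + 1)) (x : Fin n → M) :
    (χ.elim ρ).eval u P x ↔ ∃ y, χ.eval u P (Fin.snoc x y : Fin (n + 1) → M) := by
  classical
  have hsnoc : ∀ (N : ℤ) (d : Fin (n + 1) → ℤ) (z : Fin n → M) (y : M),
      (Fin.snoc (fun i => N • z i + d i.castSucc • u) (N • y + d (Fin.last n) • u) :
        Fin (n + 1) → M) =
      fun i => N • (Fin.snoc z y : Fin (n + 1) → M) i + d i • u := by
    intro N d z y
    funext i
    refine Fin.lastCases ?_ (fun i => ?_) i <;> simp
  have hpad : ∀ d : Fin (n + 1) → ℤ, 3 ≤ (paddedForms χ.modulus d χ).length := by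
    intro d
    simp [paddedForms]
  have hsub : ∀ d : Fin (n + 1) → ℤ, ∀ f ∈ χ.quotForms χ.modulus d,
      f ∈ paddedForms χ.modulus d χ := by
    intro d f hf
    simp [paddedForms, hf]
  simp only [elim, eval_disj, eval_residue_and_div hu, Finset.mem_univ, true_and,
    Finset.mem_filter, Finset.mem_powerset, eval_patternCode hρ _ (hpad _)]
  constructor
  · rintro ⟨d, z, rfl, I, ⟨-, hI⟩, y, hy⟩
    refine ⟨(χ.modulus : ℤ) • y + (d (Fin.last n) : ℤ) • u, ?_⟩
    rw [hsnoc _ (fun i => (d i : ℤ)),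
      eval_iff_truth hu P (fun i => (d i : ℤ)) I _ χ dvd_rfl fun f hf => hy f (hsub _ f hf)]
    exact hI
  · rintro ⟨y, hy⟩
    choose d z hz using hu.exists_residue χ.modulus
    set x' : Fin (n + 1) → M := Fin.snoc x y with hx'
    set z' : Fin n → M := fun i => z (x i) with hz'
    have hdx : ∀ i : Fin n, d (x' i.castSucc) = d (x i) := by
      intro i
      simp [hx']
    have hx : x = fun i => (χ.modulus : ℤ) • z' i + (d (x' i.castSucc) : ℤ) • u := by
      funext i
      rw [hdx]
      exact hz (x i)
    have hxy : x' = fun i => (χ.modulus : ℤ) • (Fin.snoc z' (z y) : Fin (n + 1) → M) i +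
        (d (x' i) : ℤ) • u := by
      rw [← hsnoc _ (fun i => (d (x' i) : ℤ)), ← hx, hx', Fin.snoc_last, ← hz y]
    set l := paddedForms χ.modulus (fun i => (d (x' i) : ℤ)) χ with hl
    set I := l.toFinset.filter
      fun f => evalForm u (Fin.snoc z' (z y) : Fin (n + 1) → M) f ∈ P with hI
    have hmem : ∀ f ∈ l, evalForm u (Fin.snoc z' (z y) : Fin (n + 1) → M) f ∈ P ↔
        f ∈ (I : Set (Form (n + 1))) := by
      intro f hf
      simp [hI, hf]
    refine ⟨fun i => d (x' i), z', hx, I, ⟨Finset.filter_subset _ _, ?_⟩, z y, hmem⟩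
    rw [← eval_iff_truth hu P _ _ (Fin.snoc z' (z y)) χ dvd_rfl
      fun f hf => hmem f (hsub _ f hf), ← hxy]
    exact hy

/-! ### Elimination of equality -/

/-- The code of `f = 0`, obtained from `¬ ∃ y, y ∈ P ∧ f + y ∉ P`. -/
noncomputable def eqZero (ρ : (p : ℕ) → (Fin p → ℤ) → Finset (Fin p) → QFCode p)
    (f : Form n) : QFCode n :=
  (((mem (coordForm (Fin.last n))).and (mem
    (substForm (fun i => coordForm i.castSucc) f + coordForm (Fin.last n))).not).elim ρ).not

/-- The properties of a structure that make quantifier elimination work, where `ρ p k I` is the code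
of `∃ y, ⋀ (x i + k i y ∈ P ↔ i ∈ I)`. -/
structure IsEliminable (ρ : (p : ℕ) → (Fin p → ℤ) → Finset (Fin p) → QFCode p)
    (u : M) (P : Set M) : Prop where
  isIntLike : IsIntLike u
  pattern : ∀ (p : ℕ), 3 ≤ p → ∀ (k : Fin p → ℤ) (I : Finset (Fin p)) (x : Fin p → M),
    (∃ y, ∀ i, x i + k i • y ∈ P ↔ i ∈ I) ↔ (ρ p k I).eval u P x
  ne_zero_iff : ∀ x : M, x ≠ 0 ↔ ∃ y, y ∈ P ∧ x + y ∉ P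

variable {ρ : (p : ℕ) → (Fin p → ℤ) → Finset (Fin p) → QFCode p}

theorem eval_eqZero {P : Set M} (h : IsEliminable ρ u P) (f : Form n) (x : Fin n → M) :
    (eqZero ρ f).eval u P x ↔ evalForm u x f = 0 := by
  rw [eqZero, eval_not, eval_elim h.isIntLike h.pattern, not_iff_comm,
    ← ne_eq, h.ne_zero_iff]
  simp

/-! ### Variable-free codes -/

theorem eval_closed_atom (hu : IsIntLike u) (P : Set M) (x : Fin 0 → M) (m : ℕ+) (s : Bool)
    (f : Form 0) :
    (atom m s f).eval u P x ↔ (m : ℤ) ∣ f.2 ∧ ((f.2 / m) • u ∈ P ↔ s = true) := by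
  simp only [eval, evalForm_apply, Finset.univ_eq_empty, Finset.sum_empty, zero_add]
  constructor
  · rintro ⟨y, hy, hs⟩
    have hd := hu.dvd_of_smul m _ y hy
    refine ⟨hd, ?_⟩
    rw [← Int.mul_ediv_cancel' hd, mul_smul] at hy
    rwa [hu.smul_cancel m hy]
  · rintro ⟨hd, hs⟩
    exact ⟨_, by rw [smul_smul, Int.mul_ediv_cancel' hd], hs⟩

/-- Two groups that resemble the integers satisfy the same variable-free codes, when their
distinguished sets contain the same multiples of the distinguished element. -/
theorem eval_closed_congr {M' : Type*} [AddCommGroup M'] {u' : M'} (hu : IsIntLike u)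
    (hu' : IsIntLike u') {P : Set M} {P' : Set M'} (h : ∀ k : ℤ, k • u ∈ P ↔ k • u' ∈ P')
    (x : Fin 0 → M) (x' : Fin 0 → M') (p : QFCode 0) :
    p.eval u P x ↔ p.eval u' P' x' := by
  induction p with
  | atom m s f => rw [eval_closed_atom hu, eval_closed_atom hu', h]
  | fls => rfl
  | imp p q hp hq => simp only [eval, hp, hq]

end QFCode

/-! ### Definable conditions on integers -/

/-- Integer-valued functions on `ℤⁿ` that are given by an affine form. -/
def IsAff {n : ℕ} (t : (Fin n → ℤ) → ℤ) : Prop :=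
  ∃ f : Form n, ∀ x, t x = evalForm 1 x f

namespace IsAff

variable {n : ℕ} {s t : (Fin n → ℤ) → ℤ}

theorem coord (i : Fin n) : IsAff fun x : Fin n → ℤ => x i :=
  ⟨coordForm i, fun x => by simp⟩

theorem const (b : ℤ) : IsAff fun _ : Fin n → ℤ => b :=
  ⟨constForm b, fun x => by simp⟩

theorem add (hs : IsAff s) (ht : IsAff t) : IsAff fun x => s x + t x := by
  obtain ⟨f, hf⟩ := hs
  obtain ⟨g, hg⟩ := ht
  exact ⟨f + g, fun x => by simp only [map_add, hf, hg]⟩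

theorem mul (c : ℤ) (hs : IsAff s) : IsAff fun x => c * s x := by
  obtain ⟨f, hf⟩ := hs
  exact ⟨c • f, fun x => by simp only [map_zsmul, hf, smul_eq_mul]⟩

theorem neg (hs : IsAff s) : IsAff fun x => -s x := by
  simpa using hs.mul (-1)

theorem sub (hs : IsAff s) (ht : IsAff t) : IsAff fun x => s x - t x := by
  simpa [sub_eq_add_neg] using hs.add ht.neg

end IsAff

/-- Conditions on `n`-tuples of integers that are given by a code, where `P` is the distinguished
set of integers. -/
def IsQFD {n : ℕ} (P : Set ℤ) (S : (Fin n → ℤ) → Prop) : Prop :=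
  ∃ χ : QFCode n, ∀ x, χ.eval 1 P x ↔ S x

namespace IsQFD

variable {n : ℕ} {P : Set ℤ} {S T : (Fin n → ℤ) → Prop}

theorem congr (hS : IsQFD P S) (h : ∀ x, T x ↔ S x) : IsQFD P T := by
  rwa [show T = S from funext fun x => propext (h x)]

theorem not (hS : IsQFD P S) : IsQFD P fun x => ¬ S x := by
  obtain ⟨p, hp⟩ := hS
  exact ⟨p.not, fun x => by simp [hp]⟩

theorem and (hS : IsQFD P S) (hT : IsQFD P T) : IsQFD P fun x => S x ∧ T x := by
  obtain ⟨p, hp⟩ := hS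
  obtain ⟨q, hq⟩ := hT
  exact ⟨p.and q, fun x => by simp [hp, hq]⟩

theorem or (hS : IsQFD P S) (hT : IsQFD P T) : IsQFD P fun x => S x ∨ T x := by
  obtain ⟨p, hp⟩ := hS
  obtain ⟨q, hq⟩ := hT
  exact ⟨p.or q, fun x => by simp [hp, hq]⟩

theorem const (c : Prop) : IsQFD P fun _ : Fin n → ℤ => c := by
  by_cases hc : c
  · exact ⟨QFCode.fls.not, fun x => by simp [QFCode.eval, hc]⟩
  · exact ⟨QFCode.fls, fun x => by simp [QFCode.eval, hc]⟩

theorem iff_const (hS : IsQFD P S) (c : Prop) : IsQFD P fun x => S x ↔ c := by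
  by_cases hc : c
  · exact hS.congr fun x => by simp [hc]
  · exact hS.not.congr fun x => by simp [hc]

theorem exists_mem {ι : Type*} {S : ι → (Fin n → ℤ) → Prop} (s : Finset ι)
    (h : ∀ i, IsQFD P (S i)) : IsQFD P fun x => ∃ i ∈ s, S i x := by
  choose p hp using h
  exact ⟨QFCode.disj s p, fun x => by simp [hp]⟩

theorem exists_fin {p : ℕ} {S : Fin p → (Fin n → ℤ) → Prop}
    (h : ∀ i, IsQFD P (S i)) : IsQFD P fun x => ∃ i, S i x :=
  (exists_mem Finset.univ h).congr fun x => by simp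

theorem const_and {c : Prop} (h : c → IsQFD P S) : IsQFD P fun x => c ∧ S x := by
  by_cases hc : c
  · exact (h hc).congr fun x => by simp [hc]
  · exact (const False).congr fun x => by simp [hc]

theorem forall_fin {p : ℕ} {S : Fin p → (Fin n → ℤ) → Prop}
    (h : ∀ i, IsQFD P (S i)) : IsQFD P fun x => ∀ i, S i x :=
  (exists_mem Finset.univ fun i => (h i).not).not.congr fun x => by simp

/-- The condition that `t x` is `m` times an element of `P`. -/
theorem dvd_and_mem {t : (Fin n → ℤ) → ℤ} (ht : IsAff t) (m : ℕ+) :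
    IsQFD P fun x => ∃ y, t x = m * y ∧ y ∈ P := by
  obtain ⟨f, hf⟩ := ht
  exact ⟨.atom m true f, fun x => by simp [QFCode.eval, hf]⟩

theorem mem {t : (Fin n → ℤ) → ℤ} (ht : IsAff t) : IsQFD P fun x => t x ∈ P :=
  (dvd_and_mem ht 1).congr fun x => by simp

/-- The condition that `t x` is divisible by `m`. -/
theorem dvd {t : (Fin n → ℤ) → ℤ} (ht : IsAff t) (m : ℕ+) :
    IsQFD P fun x => (m : ℤ) ∣ t x := by
  obtain ⟨f, hf⟩ := ht
  refine ⟨(QFCode.atom m true f).or (.atom m false f), fun x => ?_⟩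
  simp only [QFCode.eval_or, QFCode.eval, hf, smul_eq_mul, iff_true, Bool.false_eq_true, iff_false,
    ← exists_or, ← and_or_left, em, and_true]
  rfl

end IsQFD

/-- Conditions on a single integer that are given by a code. -/
def IsQFD1 (P : Set ℤ) (S : ℤ → Prop) : Prop :=
  ∀ ⦃n : ℕ⦄ (t : (Fin n → ℤ) → ℤ), IsAff t → IsQFD P fun x => S (t x)

namespace IsQFD1

variable {P : Set ℤ} {S : ℤ → Prop}

theorem of_coord (h : IsQFD P fun x : Fin 1 → ℤ => S (x 0)) : IsQFD1 P S := by
  rintro n t ⟨f, hf⟩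
  obtain ⟨p, hp⟩ := h
  exact ⟨p.subst fun _ => f, fun x => by simp [hp, hf]⟩

theorem shift (h : IsQFD1 P S) (c : ℤ) : IsQFD1 P fun w => S (w + c) :=
  fun _ t ht => h (fun x => t x + c) (ht.add (.const c))

theorem not (h : IsQFD1 P S) : IsQFD1 P fun w => ¬ S w :=
  fun _ t ht => (h t ht).not

theorem and {T : ℤ → Prop} (h : IsQFD1 P S) (h' : IsQFD1 P T) : IsQFD1 P fun w => S w ∧ T w :=
  fun _ t ht => (h t ht).and (h' t ht)

theorem or {T : ℤ → Prop} (h : IsQFD1 P S) (h' : IsQFD1 P T) : IsQFD1 P fun w => S w ∨ T w :=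
  fun _ t ht => (h t ht).or (h' t ht)

theorem const (c : Prop) : IsQFD1 P fun _ => c :=
  fun _ _ _ => .const c

theorem exists_mem {ι : Type*} {S : ι → ℤ → Prop} (s : Finset ι)
    (h : ∀ i, IsQFD1 P (S i)) : IsQFD1 P fun w => ∃ i ∈ s, S i w :=
  fun _ t ht => .exists_mem s fun i => h i t ht

theorem congr {T : ℤ → Prop} (h : IsQFD1 P S) (hT : ∀ w, T w ↔ S w) : IsQFD1 P T := by
  rwa [show T = S from funext fun x => propext (hT x)]

theorem mem : IsQFD1 P fun w => w ∈ P := fun _ _ ht => .mem ht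

theorem mul (h : IsQFD1 P S) (c : ℤ) : IsQFD1 P fun w => S (c * w) :=
  fun _ t ht => h (fun x => c * t x) (ht.mul c)

/-- Definable sets of integers stay definable under `q ↦ k q + c`. -/
theorem image (h : IsQFD1 P S) (k : ℕ+) (c : ℤ) :
    IsQFD1 P fun w => ∃ q, w = k * q + c ∧ S q := by
  refine of_coord ?_
  obtain ⟨p, hp⟩ := h (fun x : Fin 1 → ℤ => x 0) (.coord 0)
  refine ⟨(QFCode.residue k fun _ => c).and (p.div k fun _ => c), fun x => ?_⟩
  rw [QFCode.eval_residue_and_div isIntLike_int]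
  constructor
  · rintro ⟨z, rfl, hz⟩
    exact ⟨z 0, by simp, (hp z).1 hz⟩
  · rintro ⟨q, hq, hS⟩
    refine ⟨fun _ => q, funext fun i => ?_, (hp _).2 hS⟩
    rw [Subsingleton.elim i 0, hq]
    simp

end IsQFD1

/-! ### Fractional parts of the multiples of `r⁻¹` -/

/-- A set `P` of integers consists of the `k ≠ -1` with `⌊(k + 1) α⌋ = ⌊k α⌋ + 1`, where
`0 < α < 1` is irrational. -/
structure IsBeatty (P : Set ℤ) (α : ℝ) : Prop where
  irrational : Irrational α
  pos : 0 < α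
  lt_one : α < 1
  mem_iff_floor : ∀ k : ℤ, k ∈ P ↔ ⌊((k + 1 : ℤ) : ℝ) * α⌋ - ⌊(k : ℝ) * α⌋ = 1 ∧ k ≠ -1
  nonempty : P.Nonempty

theorem isBeatty_beattySet {r : ℝ} (hr : 1 < r) (hirr : Irrational r) :
    IsBeatty (beattySet r) r⁻¹ where
  irrational := irrational_inv_iff.2 hirr
  pos := by positivity
  lt_one := inv_lt_one_of_one_lt₀ hr
  nonempty := ⟨⌊((1 : ℤ) : ℝ) * r⌋, 1, one_ne_zero, rfl⟩
  mem_iff_floor k := by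
    have hr0 : 0 < r := by linarith
    have hα : 0 < r⁻¹ := by positivity
    have hα1 : r⁻¹ < 1 := inv_lt_one_of_one_lt₀ hr
    have hle : ∀ a b : ℤ, (a : ℝ) * r⁻¹ ≤ b ↔ (a : ℝ) ≤ b * r := fun a b => by
      rw [← div_eq_mul_inv, div_le_iff₀ hr0]
    have hlt : ∀ a b : ℤ, (b : ℝ) < (a : ℝ) * r⁻¹ ↔ (b : ℝ) * r < a := fun a b => by
      rw [← div_eq_mul_inv, lt_div_iff₀ hr0]
    have hne : ∀ a b : ℤ, b ≠ 0 → (a : ℝ) ≠ b * r := fun a b hb h =>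
      (hirr.intCast_mul hb).ne_int a h.symm
    have hk1 : ((k + 1 : ℤ) : ℝ) * r⁻¹ = k * r⁻¹ + r⁻¹ := by push_cast; ring
    constructor
    · rintro ⟨n, hn, hnk⟩
      rw [Int.floor_eq_iff] at hnk
      have h1 : (k : ℝ) * r⁻¹ < n := by
        have := (hle k n).2 hnk.1
        refine lt_of_le_of_ne this fun h => hne k n hn ?_
        rw [← h]; field_simp
      have h2 : (n : ℝ) < ((k + 1 : ℤ) : ℝ) * r⁻¹ := (hlt _ _).2 (by push_cast; exact hnk.2)
      have h3 : ⌊((k + 1 : ℤ) : ℝ) * r⁻¹⌋ = n := by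
        rw [Int.floor_eq_iff]
        constructor <;> linarith
      have h4 : ⌊(k : ℝ) * r⁻¹⌋ = n - 1 := by
        rw [Int.floor_eq_iff]
        push_cast
        constructor <;> linarith
      refine ⟨by omega, ?_⟩
      rintro rfl
      have h5 : (n : ℝ) < 0 := by simpa using h2
      have h6 : (-1 : ℝ) < n := by
        push_cast at h1
        linarith
      have h7 : n < 0 := by exact_mod_cast h5
      have h8 : -1 < n := by exact_mod_cast h6
      omega
    · rintro ⟨h, hk⟩
      set n := ⌊((k + 1 : ℤ) : ℝ) * r⁻¹⌋ with hn
      have h1 : (n : ℝ) ≤ ((k + 1 : ℤ) : ℝ) * r⁻¹ := Int.floor_le _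
      have h2 : (k : ℝ) * r⁻¹ < n := Int.floor_lt.1 (by omega)
      have hn0 : n ≠ 0 := by
        intro h0
        rw [h0] at h1 h2
        have h3 : (k : ℝ) < 0 := by
          by_contra hcon
          push Not at hcon
          have := mul_nonneg hcon hα.le
          simp at h2
          linarith
        have h4 : (0 : ℝ) ≤ ((k + 1 : ℤ) : ℝ) := by
          by_contra hcon
          push Not at hcon
          have := mul_neg_of_neg_of_pos hcon hα
          simp at h1
          push_cast at this
          linarith
        have h5 : k < 0 := by exact_mod_cast h3
        have h6 : 0 ≤ k + 1 := by exact_mod_cast h4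
        omega
      refine ⟨n, hn0, ?_⟩
      rw [Int.floor_eq_iff]
      refine ⟨(hle _ _).1 h2.le, ?_⟩
      have h3 : (n : ℝ) * r ≤ ((k + 1 : ℤ) : ℝ) := by
        rw [← div_eq_mul_inv, le_div_iff₀ hr0] at h1
        exact h1
      have := lt_of_le_of_ne h3 (hne _ _ hn0).symm
      push_cast at this
      exact this

namespace IsBeatty

variable {P : Set ℤ} {α : ℝ}

theorem mul_ne_int (h : IsBeatty P α) {k : ℤ} (hk : k ≠ 0) (n : ℤ) : (k : ℝ) * α ≠ n :=
  (h.irrational.intCast_mul hk).ne_int n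

theorem fract_pos (h : IsBeatty P α) {k : ℤ} (hk : k ≠ 0) : 0 < Int.fract ((k : ℝ) * α) := by
  refine lt_of_le_of_ne (Int.fract_nonneg _) fun h0 => h.mul_ne_int hk ⌊(k : ℝ) * α⌋ ?_
  have := Int.self_sub_floor ((k : ℝ) * α)
  linarith

theorem mem_iff_fract (h : IsBeatty P α) (k : ℤ) : k ∈ P ↔ 1 - α < Int.fract ((k : ℝ) * α) := by
  have h1 : ((k + 1 : ℤ) : ℝ) * α = k * α + α := by push_cast; ring
  have hf := Int.fract_nonneg ((k : ℝ) * α)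
  have hf1 := Int.fract_lt_one ((k : ℝ) * α)
  have hs := Int.self_sub_floor ((k : ℝ) * α)
  have hpos := h.pos
  have hlt := h.lt_one
  rw [h.mem_iff_floor]
  constructor
  · rintro ⟨hk, hk1⟩
    have h2 := Int.floor_le (((k + 1 : ℤ) : ℝ) * α)
    have h3 := h.mul_ne_int (k := k + 1) (by omega) ⌊((k + 1 : ℤ) : ℝ) * α⌋
    have h4 := lt_of_le_of_ne h2 h3.symm
    have h5 : (⌊((k + 1 : ℤ) : ℝ) * α⌋ : ℝ) = ⌊(k : ℝ) * α⌋ + 1 := by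
      exact_mod_cast (by omega : ⌊((k + 1 : ℤ) : ℝ) * α⌋ = ⌊(k : ℝ) * α⌋ + 1)
    linarith
  · intro hk
    constructor
    · have : ⌊((k + 1 : ℤ) : ℝ) * α⌋ = ⌊(k : ℝ) * α⌋ + 1 := by
        rw [Int.floor_eq_iff]
        push_cast at h1 ⊢
        constructor <;> linarith
      omega
    · rintro rfl
      have : Int.fract (((-1 : ℤ) : ℝ) * α) = 1 - α := by
        rw [Int.fract_eq_iff]
        exact ⟨by linarith, by linarith, -1, by push_cast; ring⟩
      linarith

theorem zero_notMem (h : IsBeatty P α) : (0 : ℤ) ∉ P := by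
  rw [h.mem_iff_fract]
  simp [h.lt_one.le]

/-- The set `P` is symmetric about `-1/2`. -/
theorem neg_one_sub_mem_iff (h : IsBeatty P α) (k : ℤ) : -1 - k ∈ P ↔ k ∈ P := by
  have key : ∀ k, k ∈ P → -1 - k ∈ P := by
    intro k hk
    rw [h.mem_iff_fract] at hk ⊢
    have hf1 := Int.fract_lt_one ((k : ℝ) * α)
    have hlt := h.lt_one
    have : Int.fract (((-1 - k : ℤ) : ℝ) * α) = 2 - α - Int.fract ((k : ℝ) * α) := by
      rw [Int.fract_eq_iff]
      refine ⟨by linarith, by linarith, -2 - ⌊(k : ℝ) * α⌋, ?_⟩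
      have := Int.self_sub_floor ((k : ℝ) * α)
      push_cast
      linarith
    linarith
  exact ⟨fun hk => by simpa using key _ hk, key k⟩

/-- Zero is the only integer `x` such that `x` and `-x` are outside `P` and `x + j` is in `P`, for
any fixed element `j` of `P`. Hence equality with zero can be expressed in terms of `P`. -/
theorem eq_zero_iff (h : IsBeatty P α) {j : ℤ} (hj : j ∈ P) (x : ℤ) :
    x = 0 ↔ x ∉ P ∧ -x ∉ P ∧ x + j ∈ P := by
  constructor
  · rintro rfl
    simpa [h.zero_notMem] using hj
  · rintro ⟨h1, h2, h3⟩
    by_contra hx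
    have hx0 := h.fract_pos hx
    have hx1 := Int.fract_lt_one ((x : ℝ) * α)
    have hj1 := Int.fract_lt_one ((j : ℝ) * α)
    have hxs := Int.self_sub_floor ((x : ℝ) * α)
    have hjs := Int.self_sub_floor ((j : ℝ) * α)
    rw [h.mem_iff_fract] at h1 h2 h3 hj
    push Not at h1 h2
    have e1 : Int.fract (((-x : ℤ) : ℝ) * α) = 1 - Int.fract ((x : ℝ) * α) := by
      rw [Int.fract_eq_iff]
      refine ⟨by linarith, by linarith, -1 - ⌊(x : ℝ) * α⌋, ?_⟩
      push_cast
      linarith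
    have e2 : Int.fract (((x + j : ℤ) : ℝ) * α) =
        Int.fract ((x : ℝ) * α) + Int.fract ((j : ℝ) * α) - 1 := by
      rw [Int.fract_eq_iff]
      refine ⟨by linarith, by linarith, ⌊(x : ℝ) * α⌋ + ⌊(j : ℝ) * α⌋ + 1, ?_⟩
      push_cast
      linarith
    linarith

theorem isQFD1_eq (h : IsBeatty P α) (c : ℤ) : IsQFD1 P fun w => w = c := by
  obtain ⟨j, hj⟩ := h.nonempty
  intro n t ht
  have ht' : IsAff fun x => t x - c := ht.sub (.const c)
  refine ((IsQFD.mem ht').not.and ((IsQFD.mem ht'.neg).not.and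
    (IsQFD.mem (ht'.add (.const j))))).congr fun x => ?_
  rw [← h.eq_zero_iff hj, sub_eq_zero]

/-- The function `w ↦ ⌊w α⌋` jumps between `w` and `w + 1` precisely if `w` is in `P` or is `-1`. -/
theorem floor_succ (h : IsBeatty P α) (w : ℤ) :
    ⌊((w + 1 : ℤ) : ℝ) * α⌋ - ⌊(w : ℝ) * α⌋ = 1 ∧ (w ∈ P ∨ w = -1) ∨
      ⌊((w + 1 : ℤ) : ℝ) * α⌋ - ⌊(w : ℝ) * α⌋ = 0 ∧ ¬ (w ∈ P ∨ w = -1) := by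
  have h1 : ((w + 1 : ℤ) : ℝ) * α = w * α + α := by push_cast; ring
  have hpos := h.pos
  have hlt := h.lt_one
  have hlo : ⌊(w : ℝ) * α⌋ ≤ ⌊((w + 1 : ℤ) : ℝ) * α⌋ := Int.floor_mono (by linarith)
  have hhi : ⌊((w + 1 : ℤ) : ℝ) * α⌋ ≤ ⌊(w : ℝ) * α⌋ + 1 := by
    rw [← Int.floor_add_one]
    exact Int.floor_mono (by linarith)
  have hm := h.mem_iff_floor w
  by_cases hw : w = -1
  · left
    refine ⟨?_, Or.inr hw⟩
    subst hw
    have : ⌊((-1 : ℤ) : ℝ) * α⌋ = -1 := by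
      rw [Int.floor_eq_iff]
      push_cast
      constructor <;> linarith
    rw [this]
    simp
  · simp only [hw, ne_eq, not_false_eq_true, and_true, or_false] at hm ⊢
    rw [hm]
    omega

theorem isQFD1_floor_add_nat (h : IsBeatty P α) (j : ℕ) (c : ℤ) :
    IsQFD1 P fun w => ⌊((w + j : ℤ) : ℝ) * α⌋ - ⌊(w : ℝ) * α⌋ = c := by
  induction j generalizing c with
  | zero => exact (IsQFD1.const (0 = c)).congr fun w => by simp
  | succ j ih =>
    have hj : IsQFD1 P fun w => w + (j : ℤ) ∈ P ∨ w + (j : ℤ) = -1 :=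
      (IsQFD1.mem.or (h.isQFD1_eq (-1))).shift j
    refine ((hj.and (ih (c - 1))).or (hj.not.and (ih c))).congr fun w => ?_
    have := h.floor_succ (w + j)
    rw [show w + ((j + 1 : ℕ) : ℤ) = w + j + 1 by push_cast; ring]
    rcases this with ⟨h1, h2⟩ | ⟨h1, h2⟩
    · simp only [h2, true_and, not_true_eq_false, false_and, or_false]
      omega
    · simp only [h2, true_and, not_false_eq_true, false_and, false_or]
      omega

theorem isQFD1_floor_add (h : IsBeatty P α) (j : ℤ) (c : ℤ) :
    IsQFD1 P fun w => ⌊((w + j : ℤ) : ℝ) * α⌋ - ⌊(w : ℝ) * α⌋ = c := by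
  obtain ⟨j, rfl | rfl⟩ := j.eq_nat_or_neg
  · exact h.isQFD1_floor_add_nat j c
  · refine ((h.isQFD1_floor_add_nat j (-c)).shift (-j)).congr fun w => ?_
    rw [neg_add_cancel_right]
    omega

theorem dense_fract (h : IsBeatty P α) {a b : ℝ} (hab : a < b) :
    ∃ m n : ℤ, a < m * α + n ∧ m * α + n < b := by
  have hd : Dense (AddSubgroup.closure {α, (1 : ℝ)} : Set ℝ) := by
    rw [dense_addSubgroupClosure_pair_iff, div_one]
    exact h.irrational
  obtain ⟨y, hy, hya, hyb⟩ := hd.exists_between hab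
  obtain ⟨m, n, rfl⟩ := AddSubgroup.mem_closure_pair.1 hy
  exact ⟨m, n, by simpa using hya, by simpa using hyb⟩

/-! ### Definable properties of `⌊w α⌋` -/

/-- The cuts `1 - {j α}` are definable in the fractional parts `{q α}`. -/
theorem isQFD1_fract_add_fract_lt (h : IsBeatty P α) (j : ℤ) :
    IsQFD1 P fun q => Int.fract ((q : ℝ) * α) + Int.fract ((j : ℝ) * α) < 1 := by
  refine (h.isQFD1_floor_add j ⌊(j : ℝ) * α⌋).congr fun q => ?_
  have hq := Int.self_sub_floor ((q : ℝ) * α)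
  have hj := Int.self_sub_floor ((j : ℝ) * α)
  have hq0 := Int.fract_nonneg ((q : ℝ) * α)
  have hj0 := Int.fract_nonneg ((j : ℝ) * α)
  have e : ((q + j : ℤ) : ℝ) * α = q * α + j * α := by push_cast; ring
  rw [sub_eq_iff_eq_add, Int.floor_eq_iff, e]
  push_cast
  constructor
  · intro hlt
    constructor <;> linarith
  · rintro ⟨-, hlt⟩
    linarith

theorem exists_fract_between (h : IsBeatty P α) {a b : ℝ} (ha : 0 ≤ a) (hab : a < b)
    (hb : b ≤ 1) : ∃ j : ℤ, a < 1 - Int.fract ((j : ℝ) * α) ∧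
      1 - Int.fract ((j : ℝ) * α) < b := by
  obtain ⟨m, n, h1, h2⟩ := h.dense_fract (a := 1 - b) (b := 1 - a) (by linarith)
  have : Int.fract ((m : ℝ) * α) = m * α + n := by
    rw [Int.fract_eq_iff]
    exact ⟨by linarith, by linarith, -n, by push_cast; ring⟩
  exact ⟨m, by linarith, by linarith⟩

/-- The rational cuts `l / k` are definable in the fractional parts `{q α}`: near `l / k`, the sign
of `{q α} - l / k` is decided by whether `k q` is in `P`. -/
theorem isQFD1_mul_fract_lt (h : IsBeatty P α) (k : ℕ+) (l : ℤ) :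
    IsQFD1 P fun q => (k : ℝ) * Int.fract ((q : ℝ) * α) < l := by
  have hk : (0 : ℝ) < (k : ℕ) := by exact_mod_cast k.pos
  rcases le_or_gt l 0 with hl | hl
  · refine (IsQFD1.const False).congr fun q => ?_
    have hl' : (l : ℝ) ≤ 0 := by exact_mod_cast hl
    have := mul_nonneg hk.le (Int.fract_nonneg ((q : ℝ) * α))
    simp only [iff_false, not_lt]
    linarith
  rcases le_or_gt (k : ℤ) l with hlk | hlk
  · refine (IsQFD1.const True).congr fun q => ?_
    have hl' : ((k : ℕ) : ℝ) ≤ l := by exact_mod_cast hlk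
    have := mul_lt_mul_of_pos_left (Int.fract_lt_one ((q : ℝ) * α)) hk
    simp only [iff_true]
    linarith
  have hl0 : (0 : ℝ) < l := by exact_mod_cast hl
  have hlk' : (l : ℝ) < (k : ℕ) := by exact_mod_cast hlk
  obtain ⟨δ, hδ, hδ1, hδ2⟩ : ∃ δ, 0 < δ ∧ δ < α ∧ δ < 1 - α := by
    obtain ⟨δ, h0, h1⟩ := exists_between (lt_min h.pos (sub_pos.2 h.lt_one))
    exact ⟨δ, h0, h1.trans_le (min_le_left _ _), h1.trans_le (min_le_right _ _)⟩
  obtain ⟨i, hi, hi'⟩ := h.exists_fract_between (a := max 0 ((l - δ) / (k : ℕ)))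
    (b := l / (k : ℕ)) (le_max_left _ _) (max_lt (by positivity) (by gcongr; linarith))
    ((div_le_one hk).2 hlk'.le)
  obtain ⟨j, hj, hj'⟩ := h.exists_fract_between (a := l / (k : ℕ))
    (b := min 1 ((l + δ) / (k : ℕ))) (by positivity)
    (lt_min ((div_lt_one hk).2 hlk') (by gcongr; linarith)) (min_le_left _ _)
  replace hi := (le_max_right _ _).trans_lt hi
  replace hj' := hj'.trans_le (min_le_right _ _)
  rw [div_lt_iff₀ hk] at hi hj
  rw [lt_div_iff₀ hk] at hi' hj'
  refine ((h.isQFD1_fract_add_fract_lt i).or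
    ((h.isQFD1_fract_add_fract_lt j).and (IsQFD1.mem.mul k))).congr fun q => ?_
  rw [h.mem_iff_fract]
  set v := Int.fract ((q : ℝ) * α) with hv
  set ci := Int.fract ((i : ℝ) * α)
  set cj := Int.fract ((j : ℝ) * α)
  have hs : (q : ℝ) * α - ⌊(q : ℝ) * α⌋ = v := Int.self_sub_floor _
  have hlow : v < 1 - ci → (k : ℕ) * v < l := fun hlt => by
    nlinarith [mul_lt_mul_of_pos_right hlt hk]
  have hlow' : 1 - ci ≤ v → (l : ℝ) - δ < (k : ℕ) * v := fun hle => by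
    nlinarith [mul_le_mul_of_nonneg_right hle hk.le]
  have hhigh : v < 1 - cj → (k : ℕ) * v < l + δ := fun hlt => by
    nlinarith [mul_lt_mul_of_pos_right hlt hk]
  have hhigh' : 1 - cj ≤ v → (l : ℝ) < (k : ℕ) * v := fun hle => by
    nlinarith [mul_le_mul_of_nonneg_right hle hk.le]
  rcases lt_or_ge v (1 - ci) with hvi | hvi
  · exact ⟨fun _ => Or.inl (by linarith), fun _ => hlow hvi⟩
  rcases lt_or_ge v (1 - cj) with hvj | hvj
  · have h1 := hlow' hvi
    have h2 := hhigh hvj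
    have hni : ¬ v + ci < 1 := by linarith
    have hyj : v + cj < 1 := by linarith
    simp only [hni, hyj, true_and, false_or]
    rcases lt_or_ge ((k : ℕ) * v) (l : ℝ) with hvl | hvl
    · have : Int.fract ((((k : ℕ) : ℤ) * q : ℤ) * α) = (k : ℕ) * v - l + 1 := by
        rw [Int.fract_eq_iff]
        refine ⟨by linarith, by linarith, (k : ℕ) * ⌊(q : ℝ) * α⌋ + l - 1, ?_⟩
        push_cast
        rw [← hs]
        ring
      rw [this]
      exact ⟨fun _ => by linarith, fun _ => hvl⟩
    · have : Int.fract ((((k : ℕ) : ℤ) * q : ℤ) * α) = (k : ℕ) * v - l := by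
        rw [Int.fract_eq_iff]
        refine ⟨by linarith, by linarith, (k : ℕ) * ⌊(q : ℝ) * α⌋ + l, ?_⟩
        push_cast
        rw [← hs]
        ring
      rw [this]
      exact ⟨fun _ => by linarith, fun _ => by linarith⟩
  · have h1 := hhigh' hvj
    have hni : ¬ v + ci < 1 := by linarith
    have hnj : ¬ v + cj < 1 := by linarith
    simp only [hni, hnj, false_and, or_false, iff_false, not_lt]
    linarith

/-- The residue of `⌊w α⌋` modulo `k` is definable. -/
theorem isQFD1_floor_emod (h : IsBeatty P α) (k : ℕ+) (c : ℤ) :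
    IsQFD1 P fun w => ⌊(w : ℝ) * α⌋ % (k : ℤ) = c := by
  have hk : (0 : ℤ) < (k : ℕ) := by exact_mod_cast k.pos
  have hA : ∀ a : ℤ, IsQFD1 P fun q => ⌊(k : ℝ) * Int.fract ((q : ℝ) * α)⌋ = a := by
    intro a
    refine ((h.isQFD1_mul_fract_lt k a).not.and (h.isQFD1_mul_fract_lt k (a + 1))).congr
      fun q => ?_
    rw [Int.floor_eq_iff, not_lt]
    push_cast
    rfl
  have hB : ∀ (e b : ℤ), IsQFD1 P fun q =>
      ⌊((k * q + e : ℤ) : ℝ) * α⌋ - ⌊((k * q : ℤ) : ℝ) * α⌋ = b :=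
    fun e b => (h.isQFD1_floor_add e b).mul k
  -- For `w = k q + e`, the residue is that of `⌊k {q α}⌋` plus the difference in `hB`.
  refine (IsQFD1.exists_mem (Finset.Ico (0 : ℤ) k) fun e =>
    (IsQFD1.exists_mem (Finset.Ico (0 : ℤ) k) fun a =>
      (IsQFD1.exists_mem (Finset.Icc (0 : ℤ) e) fun b =>
        ((hA a).and (hB e b)).and (.const ((a + b) % (k : ℤ) = c)))).image k e).congr fun w => ?_
  have hsum : ∀ q e : ℤ, ⌊((k * q + e : ℤ) : ℝ) * α⌋ % (k : ℤ) =
      (⌊(k : ℝ) * Int.fract ((q : ℝ) * α)⌋ +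
        (⌊((k * q + e : ℤ) : ℝ) * α⌋ - ⌊((k * q : ℤ) : ℝ) * α⌋)) % (k : ℤ) := by
    intro q e
    have : ((k * q : ℤ) : ℝ) * α =
        (k : ℝ) * Int.fract ((q : ℝ) * α) + ((k * ⌊(q : ℝ) * α⌋ : ℤ) : ℝ) := by
      have := Int.self_sub_floor ((q : ℝ) * α)
      push_cast
      rw [← this]
      ring
    rw [this, Int.floor_add_intCast]
    apply Int.emod_emod_of_dvd _ dvd_rfl |>.symm.trans _
    rw [show ⌊((k * q + e : ℤ) : ℝ) * α⌋ = ⌊(k : ℝ) * Int.fract ((q : ℝ) * α)⌋ +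
      (⌊((k * q + e : ℤ) : ℝ) * α⌋ - (⌊(k : ℝ) * Int.fract ((q : ℝ) * α)⌋ +
        k * ⌊(q : ℝ) * α⌋)) + k * ⌊(q : ℝ) * α⌋ by ring, Int.add_mul_emod_self_left]
    simp
  simp only [Finset.mem_Ico, Finset.mem_Icc]
  constructor
  · intro hw
    refine ⟨w % k, ⟨Int.emod_nonneg _ hk.ne', Int.emod_lt_of_pos _ hk⟩, w / k,
      (Int.mul_ediv_add_emod w k).symm, _, ⟨?_, ?_⟩, _, ⟨?_, ?_⟩, ⟨rfl, rfl⟩, ?_⟩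
    · exact Int.floor_nonneg.2 (mul_nonneg (by positivity) (Int.fract_nonneg _))
    · rw [Int.floor_lt]
      have hk' : (0 : ℝ) < (k : ℕ) := by exact_mod_cast k.pos
      have := mul_lt_mul_of_pos_left (Int.fract_lt_one (((w / k : ℤ) : ℝ) * α)) hk'
      push_cast
      linarith
    · have he := Int.emod_nonneg w hk.ne'
      have : ((k * (w / k) : ℤ) : ℝ) * α ≤ ((k * (w / k) + w % k : ℤ) : ℝ) * α :=
        mul_le_mul_of_nonneg_right (by exact_mod_cast (by omega)) h.pos.le
      have := Int.floor_mono this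
      omega
    · have he := Int.emod_nonneg w hk.ne'
      have he' : (0 : ℝ) ≤ ((w % k : ℤ) : ℝ) := by exact_mod_cast he
      have : ((k * (w / k) + w % k : ℤ) : ℝ) * α ≤
          ((k * (w / k) : ℤ) : ℝ) * α + ((w % k : ℤ) : ℝ) := by
        have := mul_le_mul_of_nonneg_left h.lt_one.le he'
        push_cast at this ⊢
        linarith
      have := Int.floor_mono this
      rw [Int.floor_add_intCast] at this
      omega
    · rw [← hsum, Int.mul_ediv_add_emod]
      exact hw
  · rintro ⟨e, -, q, rfl, a, -, b, -, ⟨rfl, rfl⟩, hc⟩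
    rw [hsum]
    exact hc

/-- The condition that the fractional part of `(w α + l) / k` is at least `1 - α` is definable. -/
theorem isQFD1_floor_div (h : IsBeatty P α) (k : ℕ+) (l : ℤ) :
    IsQFD1 P fun w => ⌊((w : ℝ) * α + l) / (k : ℕ) + α⌋ - ⌊((w : ℝ) * α + l) / (k : ℕ)⌋ = 1 := by
  have hk : (0 : ℤ) < (k : ℕ) := by exact_mod_cast k.pos
  have hk' : (0 : ℝ) < (k : ℕ) := by exact_mod_cast k.pos
  refine (IsQFD1.exists_mem (Finset.Ico (0 : ℤ) k) fun a =>
    IsQFD1.exists_mem (Finset.Icc (0 : ℤ) k) fun b =>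
      ((h.isQFD1_floor_emod k a).and (h.isQFD1_floor_add k b)).and
        (.const ((a + b + l) / (k : ℤ) - (a + l) / k = 1))).congr fun w => ?_
  have e1 : ((w : ℝ) * α + l) / (k : ℕ) + α = (((w + (k : ℕ) : ℤ) : ℝ) * α + l) / (k : ℕ) := by
    push_cast
    field_simp
    ring
  rw [e1, Int.floor_div_natCast, Int.floor_div_natCast, Int.floor_add_intCast,
    Int.floor_add_intCast]
  set s := ⌊(w : ℝ) * α⌋ with hs
  set t := ⌊((w + (k : ℕ) : ℤ) : ℝ) * α⌋ with ht
  have hdiv : (t + l) / (k : ℤ) - (s + l) / k =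
      (s % k + (t - s) + l) / (k : ℤ) - (s % k + l) / k := by
    have hs' := Int.mul_ediv_add_emod s k
    rw [show t + l = s % k + (t - s) + l + k * (s / k) by linarith,
      show s + l = s % k + l + k * (s / k) by linarith,
      Int.add_mul_ediv_left _ _ hk.ne', Int.add_mul_ediv_left _ _ hk.ne']
    ring
  rw [hdiv]
  simp only [Finset.mem_Ico, Finset.mem_Icc]
  constructor
  · intro hw
    refine ⟨_, ⟨Int.emod_nonneg _ hk.ne', Int.emod_lt_of_pos _ hk⟩, _, ⟨?_, ?_⟩, ⟨rfl, rfl⟩, hw⟩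
    · have : (w : ℝ) * α ≤ ((w + (k : ℕ) : ℤ) : ℝ) * α :=
        mul_le_mul_of_nonneg_right (by push_cast; linarith) h.pos.le
      have := Int.floor_mono this
      omega
    · have : ((w + (k : ℕ) : ℤ) : ℝ) * α ≤ (w : ℝ) * α + (((k : ℕ) : ℤ) : ℝ) := by
        have := mul_le_mul_of_nonneg_left h.lt_one.le hk'.le
        push_cast
        linarith
      have := Int.floor_mono this
      rw [Int.floor_add_intCast] at this
      omega
  · rintro ⟨a, -, b, -, ⟨rfl, rfl⟩, hc⟩
    exact hc

/-! ### Solvable patterns of membership in `P` -/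

/-- Equals `1` if the fractional part of `θ` is at least `1 - α`, and `0` otherwise, for
`0 ≤ α < 1`. -/
noncomputable def jump (α θ : ℝ) : ℤ := ⌊θ + α⌋ - ⌊θ⌋

theorem jump_add_intCast (α θ : ℝ) (m : ℤ) : jump α (θ + m) = jump α θ := by
  rw [jump, jump, add_right_comm, Int.floor_add_intCast, Int.floor_add_intCast]
  ring

theorem mem_iff_jump (h : IsBeatty P α) (k : ℤ) : k ∈ P ↔ jump α (k * α) = 1 ∧ k ≠ -1 := by
  rw [h.mem_iff_floor, jump]
  push_cast
  rw [add_one_mul]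

theorem eventually_floor_eq (θ : ℝ) (k : ℕ) :
    ∀ᶠ η in nhdsWithin (0 : ℝ) (Set.Ioi 0), ⌊θ + k * η⌋ = ⌊θ⌋ := by
  have hcont : Filter.Tendsto (fun η : ℝ => θ + k * η) (nhdsWithin 0 (Set.Ioi 0)) (nhds θ) := by
    have : Filter.Tendsto (fun η : ℝ => θ + k * η) (nhds 0) (nhds (θ + k * 0)) :=
      Continuous.tendsto (by fun_prop) 0
    rw [mul_zero, add_zero] at this
    exact this.mono_left nhdsWithin_le_nhds
  filter_upwards [hcont.eventually (gt_mem_nhds (Int.lt_floor_add_one θ)), self_mem_nhdsWithin]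
    with η h1 h2
  rw [Int.floor_eq_iff]
  have := mul_nonneg (Nat.cast_nonneg (α := ℝ) k) (le_of_lt h2)
  exact ⟨by linarith [Int.floor_le θ], h1⟩

/-- The arcs that are prescribed for `x i + k i y`, as conditions on the point `y α` of the circle,
have end points `(l - (x i + s) α) / k i`, with `s = 0, 1`. A pattern has a solution if some `y`
with `x i + k i y = -1` is one, or if all conditions are met immediately to the right of one of
these end points. -/
theorem exists_pattern_iff (h : IsBeatty P α) {n : ℕ} (k : Fin n → ℕ) (hk : ∃ i, 0 < k i)
    (I : Finset (Fin n)) (x : Fin n → ℤ) :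
    (∃ y : ℤ, ∀ j, x j + k j * y ∈ P ↔ j ∈ I) ↔
      (∃ i, 0 < k i ∧ ∃ y : ℤ, x i + k i * y = -1 ∧ ∀ j, x j + k j * y ∈ P ↔ j ∈ I) ∨
      ∃ i, 0 < k i ∧ ∃ s ∈ ({0, 1} : Finset ℤ), ∃ l ∈ Finset.Ico (0 : ℤ) (k i), ∀ j,
        (if k j = 0 then x j ∈ P else
          jump α (x j * α + k j * ((l - (x i + s) * α) / k i)) = 1) ↔ j ∈ I := by
  classical
  constructor
  · rintro ⟨y, hy⟩
    by_cases hspec : ∃ i, 0 < k i ∧ x i + k i * y = -1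
    · obtain ⟨i, hi, hiy⟩ := hspec
      exact Or.inl ⟨i, hi, y, hiy, hy⟩
    push Not at hspec
    right
    -- The last end point to the left of `y α`.
    obtain ⟨⟨i, s⟩, his, hmax⟩ := Finset.exists_max_image
      ((Finset.univ.filter fun i => 0 < k i) ×ˢ ({0, 1} : Finset ℤ))
      (fun p => (⌊k p.1 * (y * α) + (x p.1 + p.2) * α⌋ - (x p.1 + p.2) * α) / k p.1)
      (by
        obtain ⟨i, hi⟩ := hk
        exact ⟨(i, 0), by simp [hi]⟩)
    simp only [Finset.mem_product, Finset.mem_filter, Finset.mem_univ, true_and] at his hmax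
    obtain ⟨hi, hs⟩ := his
    have hmax' : ∀ j, 0 < k j → ∀ t ∈ ({0, 1} : Finset ℤ), _ := fun j hj t ht =>
      hmax (j, t) ⟨hj, ht⟩
    clear hmax
    set L := ⌊k i * (y * α) + (x i + s) * α⌋ with hL
    set e : ℝ := (L - (x i + s) * α) / k i with he
    have hkpos : ∀ j, 0 < k j → (0 : ℝ) < k j := fun j hj => by exact_mod_cast hj
    have hey : e ≤ y * α := by
      rw [he, div_le_iff₀ (hkpos i hi)]
      linarith [Int.floor_le (k i * (y * α) + (x i + s) * α)]
    have hfl : ∀ j, 0 < k j → ∀ t ∈ ({0, 1} : Finset ℤ),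
        ⌊k j * e + (x j + t) * α⌋ = ⌊k j * (y * α) + (x j + t) * α⌋ := by
      intro j hj t ht
      have h1 := hmax' j hj t ht
      rw [div_le_iff₀ (hkpos j hj)] at h1
      have h2 := mul_le_mul_of_nonneg_left hey (hkpos j hj).le
      rw [Int.floor_eq_iff]
      have h3 := Int.lt_floor_add_one (k j * (y * α) + (x j + t) * α)
      constructor <;> linarith
    have hki : (0 : ℤ) < k i := by exact_mod_cast hi
    refine ⟨i, hi, s, hs, L % k i, Finset.mem_Ico.2
      ⟨Int.emod_nonneg _ hki.ne', Int.emod_lt_of_pos _ hki⟩, fun j => ?_⟩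
    rw [← hy j]
    split_ifs with hj
    · simp [hj]
    · have hj' := Nat.pos_of_ne_zero hj
      have hLmod : ((L % k i : ℤ) : ℝ) = L - k i * (L / k i : ℤ) := by
        have := Int.mul_ediv_add_emod L (k i)
        rw [eq_sub_iff_add_eq, add_comm]
        exact_mod_cast this
      have e1 : (x j : ℝ) * α + k j * ((((L % k i : ℤ) : ℝ) - (x i + s) * α) / k i) =
          k j * e + (x j + (0 : ℤ)) * α + ((-(k j * (L / k i)) : ℤ) : ℝ) := by
        rw [hLmod, he]
        have := (hkpos i hi).ne'
        push_cast
        field_simp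
        ring
      have e2 : k j * e + (x j + (0 : ℤ)) * α + α = k j * e + (x j + (1 : ℤ)) * α := by
        push_cast
        ring
      rw [h.mem_iff_jump, and_iff_left (hspec j hj'), e1, jump_add_intCast, jump, e2,
        hfl j hj' 0 (by simp), hfl j hj' 1 (by simp), jump]
      push_cast
      rw [show (x j + k j * y : ℝ) * α = k j * (y * α) + (x j + 0) * α by ring,
        show k j * (y * α) + (x j + 0 : ℝ) * α + α = k j * (y * α) + (x j + 1) * α by ring]
  · rintro (⟨i, -, y, -, hy⟩ | ⟨i, hi, s, -, l, -, hG⟩)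
    · exact ⟨y, hy⟩
    set e : ℝ := (l - (x i + s) * α) / k i with he
    have hev : ∀ᶠ η in nhdsWithin (0 : ℝ) (Set.Ioi 0), ∀ j,
        ⌊x j * α + k j * e + k j * η⌋ = ⌊x j * α + k j * e⌋ ∧
          ⌊x j * α + k j * e + α + k j * η⌋ = ⌊x j * α + k j * e + α⌋ :=
      Filter.eventually_all.2 fun j =>
        (eventually_floor_eq _ (k j)).and (eventually_floor_eq _ (k j))
    obtain ⟨ε, hε, hsub⟩ := mem_nhdsGT_iff_exists_Ioo_subset.1 hev
    obtain ⟨m, c, h1, h2⟩ := h.dense_fract (a := e) (b := e + ε) (by simpa using hε)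
    obtain ⟨η, hη⟩ : ∃ η, m * α + c = e + η := ⟨m * α + c - e, by ring⟩
    have hη0 : 0 < η := by linarith
    have hfl := hsub (a := η) ⟨hη0, by linarith⟩
    refine ⟨m, fun j => ?_⟩
    rw [← hG j]
    split_ifs with hj
    · simp [hj]
    · have hj' : (0 : ℝ) < k j := by exact_mod_cast Nat.pos_of_ne_zero hj
      obtain ⟨f1, f2⟩ := hfl j
      have e1 : ((x j + k j * m : ℤ) : ℝ) * α =
          x j * α + k j * e + k j * η + ((-(k j * c) : ℤ) : ℝ) := by
        have : (m : ℝ) * α = e + η - c := by linarith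
        push_cast
        rw [add_mul, mul_assoc, this]
        ring
      -- The value `-1` would put a discontinuity into the interval where the floors are constant.
      have hne : x j + k j * m ≠ -1 := by
        intro hcon
        have h3 : x j * α + k j * e + α + k j * η = ((k j * c : ℤ) : ℝ) := by
          rw [hcon] at e1
          push_cast at e1 ⊢
          linarith
        rw [h3, Int.floor_intCast] at f2
        have h4 := Int.floor_le (x j * α + k j * e + α)
        rw [← f2, ← h3] at h4
        nlinarith [mul_pos hj' hη0]
      rw [h.mem_iff_jump, and_iff_left hne, e1, jump_add_intCast, jump, jump, f1,
        add_right_comm _ _ α, f2]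

theorem isQFD_pattern_nat (h : IsBeatty P α) {n : ℕ} (k : Fin n → ℕ) (I : Finset (Fin n)) :
    IsQFD P fun x : Fin n → ℤ => ∃ y : ℤ, ∀ j, x j + k j * y ∈ P ↔ j ∈ I := by
  by_cases hk : ∃ i, 0 < k i
  · refine IsQFD.congr (.or ?_ ?_) (h.exists_pattern_iff k hk I)
    · refine .exists_fin fun i => .const_and fun hi => ?_
      obtain ⟨K, hK⟩ : ∃ K : ℕ+, (K : ℕ) = k i := ⟨⟨k i, hi⟩, rfl⟩
      have hK0 : ((K : ℕ) : ℤ) ≠ 0 := by exact_mod_cast K.ne_zero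
      have ht : IsAff fun x : Fin n → ℤ => -1 - x i := (IsAff.const (-1)).sub (.coord i)
      refine ((IsQFD.dvd ht K).and (.forall_fin fun j => (IsQFD.dvd_and_mem
        (((IsAff.coord j).mul K).add (ht.mul (k j))) K).iff_const (j ∈ I))).congr fun x => ?_
      have key : ∀ y : ℤ, -1 - x i = K * y → ∀ j,
          (∃ z : ℤ, K * x j + k j * (-1 - x i) = K * z ∧ z ∈ P) ↔ x j + k j * y ∈ P := by
        intro y hy j
        rw [hy, show (K : ℤ) * x j + k j * (K * y) = K * (x j + k j * y) by ring]
        constructor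
        · rintro ⟨z, hz, hzP⟩
          rwa [mul_left_cancel₀ hK0 hz]
        · exact fun hP => ⟨_, rfl, hP⟩
      rw [← hK]
      constructor
      · rintro ⟨y, hy, hP⟩
        have hy' : -1 - x i = K * y := by linarith
        exact ⟨⟨y, hy'⟩, fun j => (key y hy' j).trans (hP j)⟩
      · rintro ⟨⟨y, hy⟩, hP⟩
        exact ⟨y, by linarith, fun j => (key y hy j).symm.trans (hP j)⟩
    · refine .exists_fin fun i => .const_and fun hi => .exists_mem _ fun s => .exists_mem _ fun l =>
        .forall_fin fun j => .iff_const ?_ _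
      split_ifs with hj
      · exact .mem (.coord j)
      · obtain ⟨K, hK⟩ : ∃ K : ℕ+, (K : ℕ) = k i := ⟨⟨k i, hi⟩, rfl⟩
        have hK0 : ((K : ℕ) : ℝ) ≠ 0 := by exact_mod_cast K.ne_zero
        refine (h.isQFD1_floor_div K (k j * l) _ (((IsAff.coord j).mul K).sub
          (((IsAff.coord i).add (.const s)).mul (k j)))).congr fun x => ?_
        rw [jump, ← hK]
        have : (x j : ℝ) * α + k j * ((l - (x i + s) * α) / (K : ℕ)) =
            ((((K : ℕ) * x j - k j * (x i + s) : ℤ) : ℝ) * α + (k j * l : ℤ)) / (K : ℕ) := by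
          push_cast
          field_simp
          ring
        rw [this]
  · push Not at hk
    refine (IsQFD.forall_fin fun j => (IsQFD.mem (.coord j)).iff_const (j ∈ I)).congr fun x => ?_
    simp [show ∀ j, k j = 0 from fun j => Nat.le_zero.1 (hk j)]

/-- The set of those `x` for which a given pattern is realized by some `y` is definable. By the
symmetry of `P`, one may assume that the coefficients of `y` are non-negative. -/
theorem isQFD_pattern (h : IsBeatty P α) {n : ℕ} (k : Fin n → ℤ) (I : Finset (Fin n)) :
    IsQFD P fun x : Fin n → ℤ => ∃ y : ℤ, ∀ j, x j + k j * y ∈ P ↔ j ∈ I := by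
  obtain ⟨p, hp⟩ := h.isQFD_pattern_nat (fun j => (k j).natAbs) I
  have hg : ∀ j, ∃ f : Form n, ∀ x : Fin n → ℤ,
      (if 0 ≤ k j then x j else -1 - x j) = evalForm 1 x f := by
    intro j
    split_ifs
    · exact IsAff.coord j
    · exact (IsAff.const (-1)).sub (.coord j)
  choose g hg using hg
  refine ⟨p.subst g, fun x => ?_⟩
  rw [QFCode.eval_subst, hp]
  refine exists_congr fun y => forall_congr' fun j => ?_
  beta_reduce
  rw [← hg]
  split_ifs with hj
  · rw [Int.natCast_natAbs, abs_of_nonneg hj]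
  · rw [← h.neg_one_sub_mem_iff, Int.natCast_natAbs, abs_of_neg (not_le.1 hj),
      show -1 - (-1 - x j + -k j * y) = x j + k j * y by ring]

theorem ne_zero_iff (h : IsBeatty P α) (x : ℤ) : x ≠ 0 ↔ ∃ y, y ∈ P ∧ x + y ∉ P := by
  constructor
  · intro hx
    have hv := h.fract_pos hx
    have hv1 := Int.fract_lt_one ((x : ℝ) * α)
    have hxs := Int.self_sub_floor ((x : ℝ) * α)
    set v := Int.fract ((x : ℝ) * α)
    have hpos := h.pos
    have hlt := h.lt_one
    -- The multiple `y α` is put into the part of the arc `(1 - α, 1)` that `x α` moves out of it.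
    obtain ⟨y, c, h1, h2⟩ := h.dense_fract (a := max (1 - α) (1 - v)) (b := min 1 (2 - v - α))
      (by rw [max_lt_iff, lt_min_iff, lt_min_iff]; refine ⟨⟨?_, ?_⟩, ?_, ?_⟩ <;> linarith)
    rw [max_lt_iff] at h1
    rw [lt_min_iff] at h2
    obtain ⟨h1, h1'⟩ := h1
    obtain ⟨h2, h2'⟩ := h2
    refine ⟨y, ?_, ?_⟩
    · rw [h.mem_iff_fract, show Int.fract ((y : ℝ) * α) = y * α + c from
        Int.fract_eq_iff.2 ⟨by linarith, h2, -c, by push_cast; ring⟩]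
      exact h1
    · rw [h.mem_iff_fract, show Int.fract (((x + y : ℤ) : ℝ) * α) = y * α + c + v - 1 from
        Int.fract_eq_iff.2 ⟨by linarith, by linarith, ⌊(x : ℝ) * α⌋ - c + 1, by
          push_cast; linarith⟩]
      linarith
  · rintro ⟨y, hy, hxy⟩ rfl
    exact hxy (by simpa using hy)

end IsBeatty

/-! ### The group structure of a model -/

/-- The interpretations of `0`, `-` and `+` in a structure for the language of groups with a
distinguished element agree with the operations of a commutative group. -/
class GroupCompatible (G : Type*) [LGrp.Structure G] [AddCommGroup G] : Prop where
  zero : ∀ v, Structure.funMap (L := LGrp) (M := G) GroupFunc.zero v = 0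
  neg : ∀ v, Structure.funMap (L := LGrp) (M := G) GroupFunc.neg v = -v 0
  add : ∀ v, Structure.funMap (L := LGrp) (M := G) GroupFunc.add v = v 0 + v 1

/-- The interpretation of the symbol `1`. -/
def unit (G : Type*) [LGrp.Structure G] : G :=
  Structure.funMap (L := LGrp) GroupFunc.one ![]

instance : GroupCompatible ℤ where
  zero _ := rfl
  neg _ := rfl
  add _ := rfl

section GroupTerms

variable {α : Type} {G : Type*} [LGrp.Structure G] (v : α → G)

/-- The term `0` in the language of groups. -/
def zeroG : LGrp.Term α := Term.func GroupFunc.zero ![]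

/-- The term `1` in the language of groups. -/
def oneG : LGrp.Term α := Term.func GroupFunc.one ![]

/-- The term `-t` in the language of groups. -/
def negG (t : LGrp.Term α) : LGrp.Term α := Term.func GroupFunc.neg ![t]

/-- The term `s + t` in the language of groups. -/
def addG (s t : LGrp.Term α) : LGrp.Term α := Term.func GroupFunc.add ![s, t]

/-- The term `m t` in the language of groups, as an iterated sum. -/
def natMulG : ℕ → LGrp.Term α → LGrp.Term α
  | 0, _ => zeroG
  | m + 1, t => addG (natMulG m t) t

theorem realize_zeroG' :
    zeroG.realize v = Structure.funMap (L := LGrp) (M := G) GroupFunc.zero ![] :=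
  congrArg (Structure.funMap (L := LGrp) (M := G) GroupFunc.zero) (Subsingleton.elim _ _)

theorem realize_oneG : oneG.realize v = unit G :=
  congrArg (Structure.funMap (L := LGrp) (M := G) GroupFunc.one) (Subsingleton.elim _ _)

theorem realize_negG' (t : LGrp.Term α) :
    (negG t).realize v = Structure.funMap (L := LGrp) (M := G) GroupFunc.neg ![t.realize v] :=
  congrArg _ (funext fun i => by rw [Subsingleton.elim i 0]; rfl)

theorem realize_addG' (s t : LGrp.Term α) :
    (addG s t).realize v =
      Structure.funMap (L := LGrp) (M := G) GroupFunc.add ![s.realize v, t.realize v] :=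
  congrArg _ (funext fun i => by fin_cases i <;> rfl)

variable [AddCommGroup G] [GroupCompatible G]

theorem realize_zeroG : zeroG.realize v = (0 : G) := by
  rw [realize_zeroG', GroupCompatible.zero]

theorem realize_addG (s t : LGrp.Term α) :
    (addG s t).realize v = s.realize v + t.realize v := by
  rw [realize_addG', GroupCompatible.add]
  rfl

theorem realize_natMulG (m : ℕ) (t : LGrp.Term α) : (natMulG m t).realize v = m • t.realize v := by
  induction m with
  | zero => rw [natMulG, realize_zeroG, zero_smul]
  | succ m ih => rw [natMulG, realize_addG, ih, succ_nsmul]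

end GroupTerms

/-- A structure that satisfies the first-order theory of `(ℤ, +, -, 0, 1)` is a commutative
group. -/
theorem exists_groupCompatible (G : Type*) [LGrp.Structure G] (h : G ≅[LGrp] ℤ) :
    ∃ _ : AddCommGroup G, GroupCompatible G := by
  have hs := fun σ => (elementarilyEquivalent_iff.1 h σ).2
  have heq : ∀ {n : ℕ} (s t : LGrp.Term (Empty ⊕ Fin n)),
      (∀ v : Empty ⊕ Fin n → ℤ, s.realize v = t.realize v) →
        ∀ x : Fin n → G, s.realize (Sum.elim default x) = t.realize (Sum.elim default x) := by
    intro n s t hst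
    have := hs (s.bdEqual t).alls (by
      refine BoundedFormula.realize_alls.2 fun x => ?_
      rw [BoundedFormula.realize_bdEqual]
      exact hst _)
    intro x
    have h2 := (BoundedFormula.realize_alls.1 this) x
    rwa [BoundedFormula.realize_bdEqual] at h2
  let add : G → G → G := fun a b => Structure.funMap (L := LGrp) GroupFunc.add ![a, b]
  let zero : G := Structure.funMap (L := LGrp) GroupFunc.zero ![]
  let neg : G → G := fun a => Structure.funMap (L := LGrp) GroupFunc.neg ![a]
  let X : Fin 3 → LGrp.Term (Empty ⊕ Fin 3) := fun i => Term.var (Sum.inr i)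
  have add_assoc' : ∀ a b c : G, add (add a b) c = add a (add b c) := by
    intro a b c
    have := heq (addG (addG (X 0) (X 1)) (X 2)) (addG (X 0) (addG (X 1) (X 2)))
      (fun v => by simp only [realize_addG, add_assoc]) ![a, b, c]
    simp only [realize_addG'] at this
    exact this
  have add_comm' : ∀ a b : G, add a b = add b a := by
    intro a b
    have := heq (addG (X 0) (X 1)) (addG (X 1) (X 0))
      (fun v => by simp only [realize_addG, add_comm]) ![a, b, a]
    simp only [realize_addG'] at this
    exact this
  have zero_add' : ∀ a : G, add zero a = a := by
    intro a
    have := heq (addG zeroG (X 0)) (X 0)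
      (fun v => by simp only [realize_addG, realize_zeroG, zero_add]) ![a, a, a]
    simp only [realize_addG', realize_zeroG'] at this
    exact this
  have neg_add' : ∀ a : G, add (neg a) a = zero := by
    intro a
    have := heq (addG (negG (X 0)) (X 0)) zeroG
      (fun v => by
        rw [realize_addG, realize_zeroG, realize_negG', GroupCompatible.neg]
        exact neg_add_cancel _) ![a, a, a]
    simp only [realize_addG', realize_zeroG', realize_negG'] at this
    exact this
  let _ : Zero G := ⟨zero⟩
  let _ : Add G := ⟨add⟩
  let _ : Neg G := ⟨neg⟩
  let inst : AddCommGroup G :=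
    { add_assoc := add_assoc'
      zero_add := zero_add'
      add_zero := fun a => (add_comm' _ _).trans (zero_add' a)
      add_comm := add_comm'
      neg_add_cancel := neg_add'
      nsmul := nsmulRec
      zsmul := zsmulRec }
  refine ⟨inst, ⟨fun v => ?_, fun v => ?_, fun v => ?_⟩⟩
  · exact congrArg (Structure.funMap (L := LGrp) (M := G) GroupFunc.zero) (Subsingleton.elim _ _)
  · exact congrArg (Structure.funMap (L := LGrp) (M := G) GroupFunc.neg)
      (funext fun i => by rw [Subsingleton.elim i 0]; rfl)
  · exact congrArg (Structure.funMap (L := LGrp) (M := G) GroupFunc.add)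
      (funext fun i => by fin_cases i <;> rfl)

/-- A model of the theory of `(ℤ, +, -, 0, 1)` has no torsion and division with remainder. -/
theorem isIntLike_of_equiv (G : Type*) [LGrp.Structure G] [AddCommGroup G] [GroupCompatible G]
    (h : G ≅[LGrp] ℤ) : IsIntLike (unit G) := by
  have hs := fun σ => (elementarilyEquivalent_iff.1 h σ).2
  have hunit : unit ℤ = 1 := rfl
  have hdvd : ∀ (m c : ℕ), 0 < c → c < m → ∀ y : G, c • unit G ≠ m • y := by
    intro m c hc hcm y
    have := hs ((natMulG c oneG).bdEqual
      (natMulG m (Term.var (Sum.inr (0 : Fin 1))))).not.alls (by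
        refine BoundedFormula.realize_alls.2 fun x => ?_
        rw [BoundedFormula.realize_not, BoundedFormula.realize_bdEqual, realize_natMulG,
          realize_natMulG, realize_oneG, hunit]
        intro heq
        have hd : (m : ℤ) ∣ c := ⟨x 0, by simpa using heq⟩
        have := Int.le_of_dvd (by exact_mod_cast hc) hd
        omega)
    have h2 := (BoundedFormula.realize_alls.1 this) ![y]
    rw [BoundedFormula.realize_not, BoundedFormula.realize_bdEqual, realize_natMulG,
      realize_natMulG, realize_oneG] at h2
    exact h2
  constructor
  · intro m x hx
    have := hs (((natMulG m (Term.var (Sum.inr (0 : Fin 1)))).bdEqual zeroG).imp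
      ((Term.var (Sum.inr (0 : Fin 1))).bdEqual zeroG)).alls (by
        refine BoundedFormula.realize_alls.2 fun x => ?_
        rw [BoundedFormula.realize_imp, BoundedFormula.realize_bdEqual,
          BoundedFormula.realize_bdEqual, realize_natMulG, realize_zeroG]
        intro hx
        exact (smul_eq_zero.1 hx).resolve_left m.ne_zero)
    have h2 := (BoundedFormula.realize_alls.1 this) ![x]
    rw [BoundedFormula.realize_imp, BoundedFormula.realize_bdEqual,
      BoundedFormula.realize_bdEqual, realize_natMulG, realize_zeroG] at h2
    exact h2 ((natCast_zsmul _ _).symm.trans hx)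
  · intro m x
    have := hs (BoundedFormula.iSup fun c : Fin m =>
      (Term.var (Sum.inr (0 : Fin 2))).bdEqual (addG (natMulG m (Term.var (Sum.inr (1 : Fin 2))))
        (natMulG c oneG))).ex.alls (by
        refine BoundedFormula.realize_alls.2 fun x => ?_
        rw [BoundedFormula.realize_ex]
        obtain ⟨c, y, hy⟩ := isIntLike_int.exists_residue m (x 0)
        refine ⟨y, BoundedFormula.realize_iSup.2 ⟨c, ?_⟩⟩
        rw [BoundedFormula.realize_bdEqual, realize_addG, realize_natMulG, realize_natMulG,
          realize_oneG, hunit]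
        simpa [Fin.snoc] using hy)
    have h2 := (BoundedFormula.realize_alls.1 this) ![x]
    rw [BoundedFormula.realize_ex] at h2
    obtain ⟨y, hy⟩ := h2
    obtain ⟨c, hc⟩ := BoundedFormula.realize_iSup.1 hy
    rw [BoundedFormula.realize_bdEqual, realize_addG, realize_natMulG, realize_natMulG,
      realize_oneG] at hc
    refine ⟨c, y, ?_⟩
    rw [natCast_zsmul, natCast_zsmul]
    exact hc
  · intro m c y hy
    have hm : (0 : ℤ) < (m : ℕ) := by exact_mod_cast m.pos
    have h0 := Int.emod_nonneg c hm.ne'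
    have h1 := Int.emod_lt_of_pos c hm
    rw [Int.dvd_iff_emod_eq_zero]
    by_contra hne
    refine hdvd m (c % (m : ℕ)).toNat (by omega) (by omega) (y - (c / (m : ℕ)) • unit G) ?_
    rw [← natCast_zsmul, ← natCast_zsmul, Int.toNat_of_nonneg h0, smul_sub, ← hy, smul_smul,
      ← sub_smul]
    congr 1
    linarith [Int.mul_ediv_add_emod c (m : ℕ)]

/-! ### Realization of terms and formulas -/

/-- The underlying structure for the language of groups of an `L_P`-structure. -/
@[reducible]
def groupReduct (M : Type*) [LP.Structure M] : LGrp.Structure M := grpToLP.reduct M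

section Realize

attribute [local instance] groupReduct divExpansion

/-- The interpretation of `P` as a set. -/
def predSet (M : Type*) [LP.Structure M] : Set M :=
  {x | Structure.RelMap (L := LP) PredRel.P ![x]}

instance (M : Type*) [LP.Structure M] : lpToLPM.IsExpansionOn M where
  map_onFunction _ _ := rfl
  map_onRelation R _ := by cases R; rfl

variable {M : Type*} [LP.Structure M] {α : Type} {n : ℕ}

theorem relMap_P (v : Fin 1 → M) :
    Structure.RelMap (L := LP) (PredRel.P : LP.Relations 1) v ↔ v 0 ∈ predSet M := by
  rw [show v = ![v 0] from funext fun i => by rw [Subsingleton.elim i 0]; rfl]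
  rfl

theorem realize_inP (t : LP.Term (α ⊕ Fin n)) (v : α → M) (x : Fin n → M) :
    (inP t).Realize v x ↔ t.realize (Sum.elim v x) ∈ predSet M :=
  relMap_P _

theorem realize_oneT (v : α → M) : oneT.realize v = unit M :=
  congrArg (Structure.funMap (L := LP) (M := M) GroupFunc.one) (Subsingleton.elim _ _)

variable [AddCommGroup M] [GroupCompatible M]

theorem realize_zeroT (v : α → M) : zeroT.realize v = (0 : M) :=
  GroupCompatible.zero _

theorem realize_negT (v : α → M) (t : LP.Term α) : (negT t).realize v = -t.realize v :=
  GroupCompatible.neg _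

theorem realize_addT (v : α → M) (s t : LP.Term α) :
    (addT s t).realize v = s.realize v + t.realize v :=
  GroupCompatible.add _

theorem realize_natMulT (v : α → M) (m : ℕ) (t : LP.Term α) :
    (natMulT m t).realize v = m • t.realize v := by
  induction m with
  | zero => rw [natMulT, realize_zeroT, zero_smul]
  | succ m ih => rw [natMulT, realize_addT, ih, succ_nsmul]

theorem realize_intMulT (v : α → M) (k : ℤ) (t : LP.Term α) :
    (intMulT k t).realize v = k • t.realize v := by
  cases k with
  | ofNat m => rw [intMulT, realize_natMulT, Int.ofNat_eq_natCast, natCast_zsmul]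
  | negSucc m => rw [intMulT, realize_negT, realize_natMulT, negSucc_zsmul]

theorem realize_numeralInP (k : ℤ) : M ⊨ numeralInP k ↔ k • unit M ∈ predSet M := by
  rw [Sentence.Realize, Formula.Realize, numeralInP, realize_inP, realize_intMulT, realize_oneT]

theorem realize_patternFormula (k : Fin n → ℤ) (I : Finset (Fin n)) (v : Empty → M)
    (x : Fin n → M) :
    (patternFormula k I).Realize v x ↔ ∃ y, ∀ i, x i + k i • y ∈ predSet M ↔ i ∈ I := by
  classical
  rw [patternFormula, BoundedFormula.realize_ex]
  refine exists_congr fun y => ?_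
  rw [BoundedFormula.realize_iInf]
  refine forall_congr' fun i => ?_
  have h : (inP (addT (Term.var (Sum.inr i.castSucc))
      (intMulT (k i) (Term.var (Sum.inr (Fin.last n))))) : LP.BoundedFormula Empty (n + 1)).Realize
        v (Fin.snoc x y) ↔ x i + k i • y ∈ predSet M := by
    rw [realize_inP, realize_addT, realize_intMulT]
    simp
  by_cases hi : i ∈ I
  · simp only [hi, if_true, iff_true, h]
  · simp only [hi, if_false, iff_false, BoundedFormula.realize_not, h]

theorem realize_divPlusFormula (m : ℕ+) (v : Empty → M) (x : Fin 1 → M) :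
    (divPlusFormula m).Realize v x ↔ ∃ y, x 0 = (m : ℤ) • y ∧ y ∈ predSet M := by
  rw [divPlusFormula, BoundedFormula.realize_ex]
  refine exists_congr fun y => ?_
  rw [BoundedFormula.realize_inf, BoundedFormula.realize_bdEqual, realize_inP, realize_natMulT,
    natCast_zsmul]
  rfl

theorem realize_divMinusFormula (m : ℕ+) (v : Empty → M) (x : Fin 1 → M) :
    (divMinusFormula m).Realize v x ↔ ∃ y, x 0 = (m : ℤ) • y ∧ y ∉ predSet M := by
  rw [divMinusFormula, BoundedFormula.realize_ex]
  refine exists_congr fun y => ?_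
  rw [BoundedFormula.realize_inf, BoundedFormula.realize_bdEqual, BoundedFormula.realize_not,
    realize_inP, realize_natMulT, natCast_zsmul]
  rfl

theorem relMap_Dplus (m : ℕ+) (v : Fin 1 → M) :
    Structure.RelMap (L := LPM) (DivRel.Dplus m : LPM.Relations 1) v ↔
      ∃ y, v 0 = (m : ℤ) • y ∧ y ∈ predSet M :=
  realize_divPlusFormula m _ v

theorem relMap_Dminus (m : ℕ+) (v : Fin 1 → M) :
    Structure.RelMap (L := LPM) (DivRel.Dminus m : LPM.Relations 1) v ↔
      ∃ y, v 0 = (m : ℤ) • y ∧ y ∉ predSet M :=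
  realize_divMinusFormula m _ v

/-! ### Codes as formulas -/

/-- An affine form as a term. -/
def formTerm (f : Form n) : LP.Term (Empty ⊕ Fin n) :=
  (List.ofFn fun i => intMulT (f.1 i) (Term.var (Sum.inr i))).foldr addT (intMulT f.2 oneT)

theorem realize_formTerm (f : Form n) (v : Empty → M) (x : Fin n → M) :
    (formTerm f).realize (Sum.elim v x) = evalForm (unit M) x f := by
  have h : ∀ (l : List (LP.Term (Empty ⊕ Fin n))) (t : LP.Term (Empty ⊕ Fin n)),
      (l.foldr addT t).realize (Sum.elim v x) =
        (l.map (Term.realize (Sum.elim v x))).sum + t.realize (Sum.elim v x) := by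
    intro l t
    induction l with
    | nil => simp
    | cons a l ih => simp [realize_addT, ih, add_assoc]
  rw [formTerm, h, List.map_ofFn, List.sum_ofFn, realize_intMulT, realize_oneT, evalForm_apply]
  congr 1
  exact Finset.sum_congr rfl fun i _ => realize_intMulT _ _ _

/-- A code as an `L_±`-formula. -/
def QFCode.toFormula : QFCode n → LPM.BoundedFormula Empty n
  | .atom m true f =>
    BoundedFormula.rel (DivRel.Dplus m : LPM.Relations 1) ![lpToLPM.onTerm (formTerm f)]
  | .atom m false f =>
    BoundedFormula.rel (DivRel.Dminus m : LPM.Relations 1) ![lpToLPM.onTerm (formTerm f)]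
  | .fls => ⊥
  | .imp p q => p.toFormula.imp q.toFormula

theorem QFCode.isQF_toFormula (p : QFCode n) : p.toFormula.IsQF := by
  induction p with
  | atom m s f => cases s <;> exact (BoundedFormula.IsAtomic.rel _ _).isQF
  | fls => exact BoundedFormula.isQF_bot
  | imp p q hp hq => exact hp.imp hq

theorem QFCode.realize_toFormula (p : QFCode n) (v : Empty → M) (x : Fin n → M) :
    p.toFormula.Realize v x ↔ p.eval (unit M) (predSet M) x := by
  induction p with
  | atom m s f =>
    cases s
    · refine (relMap_Dminus m _).trans ?_
      simp [QFCode.eval, realize_formTerm]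
    · refine (relMap_Dplus m _).trans ?_
      simp [QFCode.eval, realize_formTerm]
  | fls => rfl
  | imp p q hp hq => rw [toFormula, BoundedFormula.realize_imp, hp, hq, eval]

/-! ### Formulas as codes -/

/-- A function symbol, as an operation on affine forms. -/
def funcForm : {l : ℕ} → GroupFunc l → (Fin l → Form n) → Form n
  | _, GroupFunc.zero, _ => 0
  | _, GroupFunc.one, _ => constForm 1
  | _, GroupFunc.neg, f => -f 0
  | _, GroupFunc.add, f => f 0 + f 1

/-- A term as an affine form. -/
def termForm : LPM.Term (Empty ⊕ Fin n) → Form n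
  | Term.var (Sum.inl e) => e.elim
  | Term.var (Sum.inr i) => coordForm i
  | Term.func f ts => funcForm f fun i => termForm (ts i)

theorem evalForm_termForm (t : LPM.Term (Empty ⊕ Fin n)) (v : Empty → M) (x : Fin n → M) :
    evalForm (unit M) x (termForm t) = t.realize (Sum.elim v x) := by
  induction t with
  | var a =>
    rcases a with e | i
    · exact e.elim
    · simp [termForm]
  | func f ts ih =>
    cases f with
    | zero => exact (map_zero _).trans (GroupCompatible.zero (G := M) _).symm
    | one =>
      refine (evalForm_constForm _ _ _).trans ((one_smul _ _).trans ?_)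
      exact congrArg (Structure.funMap (L := LP) (M := M) GroupFunc.one) (Subsingleton.elim _ _)
    | neg =>
      refine (map_neg _ _).trans ?_
      rw [ih]
      exact (GroupCompatible.neg (G := M) fun i => (ts i).realize (Sum.elim v x)).symm
    | add =>
      refine (map_add _ _ _).trans ?_
      rw [ih, ih]
      exact (GroupCompatible.add (G := M) fun i => (ts i).realize (Sum.elim v x)).symm

/-- An atomic formula as a code. -/
def relCode : {l : ℕ} → DivRel l → (Fin l → Form n) → QFCode n
  | _, DivRel.P, f => .mem (f 0)
  | _, DivRel.Dplus m, f => .atom m true (f 0)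
  | _, DivRel.Dminus m, f => .atom m false (f 0)

/-- An `L_±`-formula as a code, by elimination of equality and of all quantifiers. -/
noncomputable def toCode (ρ : (p : ℕ) → (Fin p → ℤ) → Finset (Fin p) → QFCode p) :
    {n : ℕ} → LPM.BoundedFormula Empty n → QFCode n
  | _, .falsum => .fls
  | _, .equal s t => .eqZero ρ (termForm s - termForm t)
  | _, .rel R ts => relCode R fun i => termForm (ts i)
  | _, .imp φ χ => .imp (toCode ρ φ) (toCode ρ χ)
  | _, .all φ => ((toCode ρ φ).not.elim ρ).not

variable {ρ : (p : ℕ) → (Fin p → ℤ) → Finset (Fin p) → QFCode p}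

theorem eval_toCode (h : QFCode.IsEliminable ρ (unit M) (predSet M)) (φ : LPM.BoundedFormula Empty n)
    (v : Empty → M) (x : Fin n → M) :
    (toCode ρ φ).eval (unit M) (predSet M) x ↔ φ.Realize v x := by
  induction φ with
  | falsum => rfl
  | equal s t =>
    rw [toCode, QFCode.eval_eqZero h, map_sub, sub_eq_zero, evalForm_termForm s v,
      evalForm_termForm t v]
    rfl
  | rel R ts =>
    cases R with
    | P =>
      refine (QFCode.eval_mem _ _ _ _).trans ?_
      rw [evalForm_termForm _ v]
      exact (relMap_P fun i => (ts i).realize (Sum.elim v x)).symm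
    | Dplus m =>
      refine Iff.trans ?_ (relMap_Dplus m _).symm
      simp [toCode, relCode, QFCode.eval, evalForm_termForm _ v]
    | Dminus m =>
      refine Iff.trans ?_ (relMap_Dminus m _).symm
      simp [toCode, relCode, QFCode.eval, evalForm_termForm _ v]
  | imp φ χ hφ hχ => rw [toCode, QFCode.eval, hφ, hχ, BoundedFormula.realize_imp]
  | all φ ih =>
    rw [toCode, QFCode.eval_not, QFCode.eval_elim h.isIntLike h.pattern,
      BoundedFormula.realize_all]
    simp [ih]

end Realize

/-! ### The choice of the formulas `ψ` -/

section Family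

attribute [local instance] groupReduct divExpansion

/-- The quantifier-free formula `f ≠ 0`, for an affine form `f`. -/
def neZeroFormula {n : ℕ} (f : Form n) : LPM.BoundedFormula Empty n :=
  ((lpToLPM.onTerm (formTerm f)).bdEqual (lpToLPM.onTerm zeroT)).not

theorem isQF_neZeroFormula {n : ℕ} (f : Form n) : (neZeroFormula f).IsQF :=
  (BoundedFormula.IsAtomic.equal _ _).isQF.not

/-- The choice of the formulas `ψ`. They are given by codes, and hence free of equality, with three
exceptions. These express equality, the symmetry of `P` about `-1/2`, and `0 ∉ P`. -/
noncomputable def starFamily (ρ : (p : ℕ) → (Fin p → ℤ) → Finset (Fin p) → QFCode p) :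
    FormulaFamily
  | 1, k, I =>
    if k = ![0] ∧ I = {0} then
      (QFCode.mem (coordForm 0)).toFormula ⊓ neZeroFormula (coordForm 0)
    else (ρ 1 k I).toFormula
  | 2, k, I =>
    if k = ![1, 1] ∧ I = {0} then neZeroFormula (coordForm 1 - coordForm 0)
    else if k = ![1, -1] ∧ I = {0} then
      neZeroFormula (constForm (-1) - coordForm 1 - coordForm 0)
    else (ρ 2 k I).toFormula
  | p, k, I => (ρ p k I).toFormula

variable (ρ : (p : ℕ) → (Fin p → ℤ) → Finset (Fin p) → QFCode p)

theorem isQF_starFamily (n : ℕ) (k : Fin n → ℤ) (I : Finset (Fin n)) :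
    (starFamily ρ n k I).IsQF := by
  unfold starFamily
  split
  · split_ifs
    · exact (QFCode.isQF_toFormula _).inf (isQF_neZeroFormula _)
    · exact QFCode.isQF_toFormula _
  · split_ifs
    · exact isQF_neZeroFormula _
    · exact isQF_neZeroFormula _
    · exact QFCode.isQF_toFormula _
  · exact QFCode.isQF_toFormula _

theorem starFamily_of_three_le {n : ℕ} (hn : 3 ≤ n) (k : Fin n → ℤ) (I : Finset (Fin n)) :
    starFamily ρ n k I = (ρ n k I).toFormula := by
  obtain ⟨m, rfl⟩ := Nat.exists_eq_add_of_le' hn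
  rfl

variable {M : Type*} [LP.Structure M] [AddCommGroup M] [GroupCompatible M]

theorem realize_neZeroFormula {n : ℕ} (f : Form n) (v : Empty → M) (x : Fin n → M) :
    (neZeroFormula f).Realize v x ↔ evalForm (unit M) x f ≠ 0 := by
  rw [neZeroFormula, BoundedFormula.realize_not, BoundedFormula.realize_bdEqual,
    LHom.realize_onTerm, LHom.realize_onTerm, realize_formTerm, realize_zeroT]

theorem holds_starSentence {n : ℕ} (k : Fin n → ℤ) (I : Finset (Fin n))
    (ψ : LPM.BoundedFormula Empty n) :
    Holds M (starSentence k I ψ) ↔ ∀ x : Fin n → M,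
      (∃ y, ∀ i, x i + k i • y ∈ predSet M ↔ i ∈ I) ↔ ψ.Realize default x := by
  refine BoundedFormula.realize_alls.trans (forall_congr' fun x => ?_)
  rw [BoundedFormula.realize_iff, LHom.realize_onBoundedFormula, realize_patternFormula]

/-- All sentences `∀ x (φ_{k,I}(x) ↔ ψ_{k,I}(x))`, for the given choice of the formulas `ψ`. -/
def HoldsAll (M : Type*) [LP.Structure M] (ψ : FormulaFamily) : Prop :=
  ∀ (n : ℕ) (k : Fin n → ℤ) (I : Finset (Fin n)), Holds M (starSentence k I (ψ n k I))

variable {ρ}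

theorem exists_mem_add_notMem_iff (h : HoldsAll M (starFamily ρ)) (a b : M) :
    (∃ y, a + y ∈ predSet M ∧ b + y ∉ predSet M) ↔ b - a ≠ 0 := by
  have := (holds_starSentence _ _ _).1 (h 2 ![1, 1] {0}) ![a, b]
  simpa [starFamily, realize_neZeroFormula] using this

theorem exists_mem_sub_notMem_iff (h : HoldsAll M (starFamily ρ)) (a b : M) :
    (∃ y, a + y ∈ predSet M ∧ b - y ∉ predSet M) ↔ -unit M - b - a ≠ 0 := by
  have := (holds_starSentence _ _ _).1 (h 2 ![1, -1] {0}) ![a, b]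
  simpa [starFamily, realize_neZeroFormula, sub_eq_add_neg] using this

theorem zero_notMem_predSet (h : HoldsAll M (starFamily ρ)) : (0 : M) ∉ predSet M := by
  have := (holds_starSentence _ _ _).1 (h 1 ![0] {0}) ![0]
  simpa [starFamily, realize_neZeroFormula] using this

theorem neg_unit_sub_mem_predSet_iff (h : HoldsAll M (starFamily ρ)) (x : M) :
    -unit M - x ∈ predSet M ↔ x ∈ predSet M := by
  have key : ∀ x ∈ predSet M, -unit M - x ∈ predSet M := by
    intro x hx
    by_contra hcon
    refine (exists_mem_sub_notMem_iff h 0 (-unit M)).1 ⟨x, by simpa using hx, hcon⟩ ?_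
    simp
  refine ⟨fun hx => ?_, key x⟩
  simpa using key _ hx

theorem isEliminable_of_holdsAll (hM : IsIntLike (unit M)) (h : HoldsAll M (starFamily ρ)) :
    QFCode.IsEliminable ρ (unit M) (predSet M) where
  isIntLike := hM
  pattern p hp k I x := by
    have := (holds_starSentence _ _ _).1 (h p k I) x
    rwa [starFamily_of_three_le ρ hp, QFCode.realize_toFormula] at this
  ne_zero_iff x := by
    have := exists_mem_add_notMem_iff h 0 x
    simpa using this.symm

/-- Conversely, the sentences for the chosen family follow from the properties that they are meant
to express. -/
theorem holdsAll_starFamily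
    (hρ : ∀ (p : ℕ) (k : Fin p → ℤ) (I : Finset (Fin p)) (x : Fin p → M),
      (∃ y, ∀ i, x i + k i • y ∈ predSet M ↔ i ∈ I) ↔ (ρ p k I).eval (unit M) (predSet M) x)
    (hne : ∀ x : M, x ≠ 0 ↔ ∃ y, y ∈ predSet M ∧ x + y ∉ predSet M)
    (hneg : ∀ x : M, -unit M - x ∈ predSet M ↔ x ∈ predSet M)
    (h0 : (0 : M) ∉ predSet M) : HoldsAll M (starFamily ρ) := by
  have hne' : ∀ a b : M, (∃ y, a + y ∈ predSet M ∧ b + y ∉ predSet M) ↔ b - a ≠ 0 := by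
    intro a b
    rw [hne]
    constructor
    · rintro ⟨y, h1, h2⟩
      exact ⟨a + y, h1, by rwa [← add_assoc, sub_add_cancel]⟩
    · rintro ⟨y, h1, h2⟩
      exact ⟨y - a, by rwa [add_sub_cancel], by rwa [← add_sub_assoc, ← sub_add_eq_add_sub]⟩
  intro n k I
  rw [holds_starSentence]
  intro x
  unfold starFamily
  split
  · split_ifs with hkI
    · obtain ⟨rfl, rfl⟩ := hkI
      rw [BoundedFormula.realize_inf, QFCode.realize_toFormula, realize_neZeroFormula]
      simp only [QFCode.eval_mem, evalForm_coordForm]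
      constructor
      · rintro ⟨y, hy⟩
        have : x 0 ∈ predSet M := by simpa using hy
        exact ⟨this, fun h => h0 (h ▸ this)⟩
      · rintro ⟨hx, -⟩
        exact ⟨0, by simpa using hx⟩
    · rw [QFCode.realize_toFormula, hρ]
  · split_ifs with hkI hkI'
    · obtain ⟨rfl, rfl⟩ := hkI
      rw [realize_neZeroFormula]
      simpa using hne' (x 0) (x 1)
    · obtain ⟨rfl, rfl⟩ := hkI'
      have hflip : ∀ y, x 1 - y ∉ predSet M ↔ -unit M - x 1 + y ∉ predSet M := fun y => by
        rw [← hneg (x 1 - y), sub_sub_eq_add_sub, sub_add_eq_add_sub]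
      have := hne' (x 0) (-unit M - x 1)
      simp only [← hflip] at this
      rw [realize_neZeroFormula]
      simpa [sub_eq_add_neg] using this
    · rw [QFCode.realize_toFormula, hρ]
  · rw [QFCode.realize_toFormula, hρ]

end Family

/-! ### The standard model -/

section Standard

attribute [local instance] groupReduct divExpansion

instance (r : ℝ) : AddCommGroup (BeattyInt r) := inferInstanceAs (AddCommGroup ℤ)

instance (r : ℝ) : GroupCompatible (BeattyInt r) where
  zero _ := rfl
  neg _ := rfl
  add _ := rfl

/-- The theory of `(ℤ, +, -, 0, 1)` is part of the theory of `(ℤ, +, -, 0, 1, P_r)`. -/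
instance isExpansionOn_beattyInt (r : ℝ) :
    @LHom.IsExpansionOn LGrp LP grpToLP ℤ intGrpStructure (beattyStructure r) :=
  @LHom.IsExpansionOn.mk LGrp LP grpToLP ℤ intGrpStructure (beattyStructure r)
    (fun _ _ => rfl) (fun R _ => Empty.elim R)

theorem predSet_beattyInt (r : ℝ) : predSet (BeattyInt r) = beattySet r := rfl

/-- A choice of codes for the solvable patterns in `(ℤ, +, -, 0, 1, P_r)`. -/
theorem exists_patternCodes {r : ℝ} (hr : 1 < r) (hirr : Irrational r) :
    ∃ ρ : (p : ℕ) → (Fin p → ℤ) → Finset (Fin p) → QFCode p,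
      ∀ (p : ℕ) (k : Fin p → ℤ) (I : Finset (Fin p)) (x : Fin p → ℤ),
        (∃ y : ℤ, ∀ i, x i + k i • y ∈ beattySet r ↔ i ∈ I) ↔
          (ρ p k I).eval 1 (beattySet r) x := by
  choose ρ hρ using fun (p : ℕ) (k : Fin p → ℤ) (I : Finset (Fin p)) =>
    (isBeatty_beattySet hr hirr).isQFD_pattern k I
  exact ⟨ρ, fun p k I x => (hρ p k I x).symm⟩

end Standard

/-! ### Replacing the predicates `D_{m,±}` by their definitions -/

section Undefine

attribute [local instance] groupReduct divExpansion

/-- A term of `L_±` is a term of `L_P`. -/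
def plainTerm {α : Type} : LPM.Term α → LP.Term α
  | Term.var a => Term.var a
  | Term.func f ts => Term.func f fun i => plainTerm (ts i)

/-- The formula `∃ y (t = m y ∧ y ∈ P)` for `s = true`, and `∃ y (t = m y ∧ y ∉ P)` for
`s = false`. -/
def divFormula {n : ℕ} (m : ℕ+) (s : Bool) (t : LP.Term (Empty ⊕ Fin n)) :
    LP.BoundedFormula Empty n :=
  (((t.relabel (Sum.map id Fin.castSucc)).bdEqual
      (natMulT m (Term.var (Sum.inr (Fin.last n))))) ⊓
    (bif s then inP (Term.var (Sum.inr (Fin.last n)))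
      else (inP (Term.var (Sum.inr (Fin.last n)))).not)).ex

/-- An atomic formula of `L_±` as a formula of `L_P`. -/
def plainRel {n : ℕ} : {l : ℕ} → DivRel l → (Fin l → LP.Term (Empty ⊕ Fin n)) →
    LP.BoundedFormula Empty n
  | _, DivRel.P, ts => inP (ts 0)
  | _, DivRel.Dplus m, ts => divFormula m true (ts 0)
  | _, DivRel.Dminus m, ts => divFormula m false (ts 0)

/-- An `L_±`-formula as an `L_P`-formula. -/
def plainFormula : {n : ℕ} → LPM.BoundedFormula Empty n → LP.BoundedFormula Empty n
  | _, .falsum => .falsum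
  | _, .equal s t => .equal (plainTerm s) (plainTerm t)
  | _, .rel R ts => plainRel R fun i => plainTerm (ts i)
  | _, .imp φ χ => .imp (plainFormula φ) (plainFormula χ)
  | _, .all φ => .all (plainFormula φ)

variable {M : Type*} [LP.Structure M]

theorem realize_plainTerm {α : Type} (t : LPM.Term α) (v : α → M) :
    (plainTerm t).realize v = t.realize v := by
  induction t with
  | var a => rfl
  | func f ts ih => exact congrArg (Structure.funMap (L := LP) (M := M) f) (funext ih)

variable [AddCommGroup M] [GroupCompatible M]

theorem realize_divFormula {n : ℕ} (m : ℕ+) (s : Bool) (t : LP.Term (Empty ⊕ Fin n))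
    (v : Empty → M) (x : Fin n → M) :
    (divFormula m s t).Realize v x ↔
      ∃ y, t.realize (Sum.elim v x) = (m : ℤ) • y ∧ (y ∈ predSet M ↔ s = true) := by
  rw [divFormula, BoundedFormula.realize_ex]
  refine exists_congr fun y => ?_
  have h : (Sum.elim v (Fin.snoc x y : Fin (n + 1) → M)) ∘ Sum.map id Fin.castSucc =
      Sum.elim v x := by
    funext a
    rcases a with a | i <;> simp
  rw [BoundedFormula.realize_inf, BoundedFormula.realize_bdEqual, Term.realize_relabel, h,
    realize_natMulT, natCast_zsmul]
  cases s <;> simp [realize_inP]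

theorem realize_plainFormula {n : ℕ} (φ : LPM.BoundedFormula Empty n) (v : Empty → M)
    (x : Fin n → M) : (plainFormula φ).Realize v x ↔ φ.Realize v x := by
  induction φ with
  | falsum => rfl
  | equal s t =>
    change (plainTerm s).realize _ = (plainTerm t).realize _ ↔ _
    rw [realize_plainTerm, realize_plainTerm]
    rfl
  | rel R ts =>
    cases R with
    | P =>
      refine (realize_inP _ _ _).trans ?_
      rw [realize_plainTerm]
      exact (relMap_P fun i => (ts i).realize (Sum.elim v x)).symm
    | Dplus m =>
      refine (realize_divFormula m true _ v x).trans (Iff.trans ?_ (relMap_Dplus m _).symm)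
      simp [realize_plainTerm]
    | Dminus m =>
      refine (realize_divFormula m false _ v x).trans (Iff.trans ?_ (relMap_Dminus m _).symm)
      simp [realize_plainTerm]
  | imp φ χ hφ hχ => rw [plainFormula, BoundedFormula.realize_imp, hφ, hχ,
      BoundedFormula.realize_imp]
  | all φ ih =>
    rw [plainFormula, BoundedFormula.realize_all, BoundedFormula.realize_all]
    exact forall_congr' fun y => ih _

theorem holds_iff_plainFormula (φ : LPM.Sentence) : Holds M φ ↔ M ⊨ plainFormula φ :=
  (realize_plainFormula φ _ _).symm

end Undefine

/-! ### Elementary equivalence -/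

section Equivalence

attribute [local instance] groupReduct divExpansion

/-- Elementary equivalence of `L_P`-structures restricts to the language of groups. -/
theorem groupReduct_equiv {r : ℝ} {M : Type*} [LP.Structure M] (h : M ≅[LP] BeattyInt r) :
    M ≅[LGrp] ℤ := by
  rw [elementarilyEquivalent_iff] at h ⊢
  intro σ
  have h1 := @LHom.realize_onSentence LGrp LP M (groupReduct M) _ grpToLP
    (LHom.isExpansionOn_reduct grpToLP M) σ
  have h2 := @LHom.realize_onSentence LGrp LP ℤ intGrpStructure (beattyStructure r) grpToLP
    (isExpansionOn_beattyInt r) σ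
  exact h1.symm.trans ((h _).trans h2)

theorem isIntLike_beattyInt (r : ℝ) : IsIntLike (unit (BeattyInt r)) := isIntLike_int

theorem realize_numeralInP_beattyInt (r : ℝ) (k : ℤ) :
    BeattyInt r ⊨ numeralInP k ↔ k ∈ beattySet r := by
  rw [realize_numeralInP, predSet_beattyInt]
  exact iff_of_eq (congrArg (· ∈ beattySet r) (mul_one k))

variable {ρ : (p : ℕ) → (Fin p → ℤ) → Finset (Fin p) → QFCode p} {r : ℝ}

theorem holdsAll_beattyInt (hr : 1 < r) (hirr : Irrational r)
    (hρ : ∀ (p : ℕ) (k : Fin p → ℤ) (I : Finset (Fin p)) (x : Fin p → ℤ),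
      (∃ y : ℤ, ∀ i, x i + k i • y ∈ beattySet r ↔ i ∈ I) ↔
        (ρ p k I).eval 1 (beattySet r) x) :
    HoldsAll (BeattyInt r) (starFamily ρ) :=
  have h := isBeatty_beattySet hr hirr
  holdsAll_starFamily hρ h.ne_zero_iff h.neg_one_sub_mem_iff h.zero_notMem

/-- The axioms determine the truth of all `L_±`-sentences. -/
theorem holds_iff_of_axioms (hr : HoldsAll (BeattyInt r) (starFamily ρ)) {M : Type*} [LP.Structure M]
    (h1 : M ≅[LGrp] ℤ) (h2 : HoldsAll M (starFamily ρ))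
    (h3 : ∀ k : ℤ, k ∈ beattySet r ↔ M ⊨ numeralInP k) (φ : LPM.Sentence) :
    Holds M φ ↔ Holds (BeattyInt r) φ := by
  obtain ⟨_, _⟩ := exists_groupCompatible M h1
  have hM := isIntLike_of_equiv M h1
  refine (eval_toCode (isEliminable_of_holdsAll hM h2) φ default default).symm.trans ?_
  refine Iff.trans ?_ (eval_toCode (isEliminable_of_holdsAll (isIntLike_beattyInt r) hr)
    φ default default)
  refine QFCode.eval_closed_congr hM (isIntLike_beattyInt r) (fun k => ?_) _ _ _
  rw [← realize_numeralInP, ← realize_numeralInP, ← h3, realize_numeralInP_beattyInt]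

/-- The axioms characterize the structures that are elementarily equivalent to
`(ℤ, +, -, 0, 1, P_r)`. -/
theorem equiv_iff_axioms (hr : HoldsAll (BeattyInt r) (starFamily ρ)) (M : Type*) [LP.Structure M] :
    M ≅[LP] BeattyInt r ↔ (M ≅[LGrp] ℤ) ∧ HoldsAll M (starFamily ρ) ∧
      ∀ k : ℤ, k ∈ beattySet r ↔ M ⊨ numeralInP k := by
  constructor
  · intro h
    have h1 := groupReduct_equiv h
    obtain ⟨_, _⟩ := exists_groupCompatible M h1
    rw [elementarilyEquivalent_iff] at h
    refine ⟨h1, fun n k I => ?_, fun k => ?_⟩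
    · rw [holds_iff_plainFormula, h, ← holds_iff_plainFormula]
      exact hr n k I
    · rw [h, realize_numeralInP_beattyInt]
  · rintro ⟨h1, h2, h3⟩
    rw [elementarilyEquivalent_iff]
    intro σ
    have := holds_iff_of_axioms hr h1 h2 h3 (lpToLPM.onSentence σ)
    rwa [Holds, Holds, LHom.realize_onSentence, LHom.realize_onSentence] at this

end Equivalence

/-! ### Completeness of the theory -/

section Complete

variable {ρ : (p : ℕ) → (Fin p → ℤ) → Finset (Fin p) → QFCode p} {r : ℝ}

theorem divExpansion_model (hr : HoldsAll (BeattyInt r) (starFamily ρ)) :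
    @Theory.Model LPM (BeattyInt r) (divExpansion (BeattyInt r)) (TrStar r (starFamily ρ)) := by
  let _ := divExpansion (BeattyInt r)
  refine ⟨?_⟩
  rintro σ (((((⟨τ, hτ, rfl⟩ | ⟨n, k, I, rfl⟩) | ⟨m, rfl⟩) | ⟨m, rfl⟩) | ⟨k, -, hk, rfl⟩) |
    ⟨k, -, hk, rfl⟩)
  · have hexp : @LHom.IsExpansionOn LGrp LPM (lpToLPM.comp grpToLP) ℤ intGrpStructure
        (divExpansion (BeattyInt r)) :=
      @LHom.IsExpansionOn.mk LGrp LPM (lpToLPM.comp grpToLP) ℤ intGrpStructure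
        (divExpansion (BeattyInt r)) (fun _ _ => rfl) (fun R _ => Empty.elim R)
    exact (@LHom.realize_onSentence LGrp LPM ℤ intGrpStructure (divExpansion (BeattyInt r))
      (lpToLPM.comp grpToLP) hexp τ).2 hτ
  · exact hr n k I
  · refine BoundedFormula.realize_alls.2 fun x => ?_
    rw [BoundedFormula.realize_iff, LHom.realize_onBoundedFormula]
    exact iff_of_eq (congrArg ((divPlusFormula m).Realize default)
      (funext fun i => by rw [Subsingleton.elim i 0]; rfl))
  · refine BoundedFormula.realize_alls.2 fun x => ?_
    rw [BoundedFormula.realize_iff, LHom.realize_onBoundedFormula]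
    exact iff_of_eq (congrArg ((divMinusFormula m).Realize default)
      (funext fun i => by rw [Subsingleton.elim i 0]; rfl))
  · rw [LHom.realize_onSentence, realize_numeralInP_beattyInt]
    exact hk
  · rw [LHom.realize_onSentence, Sentence.realize_not, realize_numeralInP_beattyInt]
    exact hk

attribute [local instance] groupReduct

/-- A model of `T_r^*` satisfies the same sentences as the standard one. -/
theorem realize_iff_of_model (hr : 1 < r) (hirr : Irrational r)
    (hstd : HoldsAll (BeattyInt r) (starFamily ρ)) (N : Type*)
    [inst : LPM.Structure N] (hN : N ⊨ TrStar r (starFamily ρ)) (φ : LPM.Sentence) :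
    N ⊨ φ ↔ Holds (BeattyInt r) φ := by
  let _ := lpToLPM.reduct N
  have hmem : ∀ σ ∈ TrStar r (starFamily ρ), N ⊨ σ := fun σ hσ => hN.realize_of_mem σ hσ
  have hexp : lpToLPM.IsExpansionOn N := LHom.isExpansionOn_reduct lpToLPM N
  have hatom : ∀ (R : DivRel 1) (v : Fin 1 → N),
      (atomX R).Realize default v ↔ Structure.RelMap (L := LPM) (R : LPM.Relations 1) v :=
    fun R v => iff_of_eq (congrArg (Structure.RelMap (L := LPM) (R : LPM.Relations 1))
      (funext fun i => by rw [Subsingleton.elim i 0]; rfl))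
  -- By the axioms on `D_{m,±}`, the given structure is the expansion of its `L_P`-reduct.
  have hstr : inst = divExpansion N := by
    refine Structure.ext rfl ?_
    funext n R v
    cases R with
    | P => rfl
    | Dplus m =>
      have := BoundedFormula.realize_alls.1
        (hmem _ (Or.inl (Or.inl (Or.inl (Or.inr ⟨m, rfl⟩))))) v
      rw [BoundedFormula.realize_iff, LHom.realize_onBoundedFormula, hatom] at this
      exact propext this
    | Dminus m =>
      have := BoundedFormula.realize_alls.1
        (hmem _ (Or.inl (Or.inl (Or.inr ⟨m, rfl⟩)))) v
      rw [BoundedFormula.realize_iff, LHom.realize_onBoundedFormula, hatom] at this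
      exact propext this
  have hholds : ∀ σ : LPM.Sentence, N ⊨ σ ↔ Holds N σ := by
    intro σ
    rw [Holds, ← hstr]
  have hstar : HoldsAll N (starFamily ρ) := fun n k I =>
    (hholds _).1 (hmem _ (Or.inl (Or.inl (Or.inl (Or.inl (Or.inr ⟨n, k, I, rfl⟩))))))
  have hgrp : ∀ τ : LGrp.Sentence, ℤ ⊨ τ → N ⊨ τ := by
    intro τ hτ
    have hexp' : (lpToLPM.comp grpToLP).IsExpansionOn N :=
      ⟨fun _ _ => rfl, fun R _ => Empty.elim R⟩
    exact (LHom.realize_onSentence N (lpToLPM.comp grpToLP) τ).1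
      (hmem _ (Or.inl (Or.inl (Or.inl (Or.inl (Or.inl ⟨τ, hτ, rfl⟩))))))
  have hequiv : N ≅[LGrp] ℤ := by
    rw [elementarilyEquivalent_iff]
    refine fun τ => ⟨fun h => ?_, hgrp τ⟩
    by_contra hcon
    exact (Sentence.realize_not N).1 (hgrp τ.not ((Sentence.realize_not ℤ).2 hcon)) h
  have hpos : ∀ k : ℤ, 0 < k → (k ∈ beattySet r ↔ N ⊨ numeralInP k) := by
    intro k hk
    by_cases hkr : k ∈ beattySet r
    · have := hmem _ (Or.inl (Or.inr ⟨k, hk, hkr, rfl⟩))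
      rw [LHom.realize_onSentence] at this
      exact iff_of_true hkr this
    · have := hmem _ (Or.inr ⟨k, hk, hkr, rfl⟩)
      rw [LHom.realize_onSentence, Sentence.realize_not] at this
      exact iff_of_false hkr this
  rw [hholds]
  refine holds_iff_of_axioms hstd hequiv hstar (fun k => ?_) φ
  -- The integers `k ≤ 0` are covered by `0 ∉ P` and the symmetry of `P` about `-1/2`.
  have hP := isBeatty_beattySet hr hirr
  obtain ⟨_, _⟩ := exists_groupCompatible N hequiv
  have hsymm : N ⊨ numeralInP (-1 - k) ↔ N ⊨ numeralInP k := by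
    rw [realize_numeralInP, realize_numeralInP, ← neg_unit_sub_mem_predSet_iff hstar (k • unit N),
      sub_smul, neg_one_smul]
  have hzero : ∀ j : ℤ, j = 0 → (j ∈ beattySet r ↔ N ⊨ numeralInP j) := by
    rintro j rfl
    rw [realize_numeralInP, zero_smul]
    exact iff_of_false hP.zero_notMem (zero_notMem_predSet hstar)
  rcases lt_trichotomy k 0 with hk | hk | hk
  · rw [← hP.neg_one_sub_mem_iff, ← hsymm]
    rcases eq_or_ne k (-1) with hk1 | hk1
    · exact hzero _ (by omega)
    · exact hpos _ (by omega)
  · exact hzero _ hk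
  · exact hpos _ hk

theorem isComplete_trStar (hr : 1 < r) (hirr : Irrational r)
    (hstd : HoldsAll (BeattyInt r) (starFamily ρ)) : (TrStar r (starFamily ρ)).IsComplete := by
  refine ⟨?_, fun φ => ?_⟩
  · let _ := divExpansion (BeattyInt r)
    have := divExpansion_model hstd
    have : Nonempty (BeattyInt r) := ⟨(0 : ℤ)⟩
    exact Theory.Model.isSatisfiable (BeattyInt r)
  · rw [Theory.models_sentence_iff, Theory.models_sentence_iff]
    by_cases hφ : Holds (BeattyInt r) φ
    · exact Or.inl fun N => (realize_iff_of_model hr hirr hstd N N.is_model φ).2 hφ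
    · refine Or.inr fun N => (Sentence.realize_not _).2 fun h => hφ ?_
      exact (realize_iff_of_model hr hirr hstd N N.is_model φ).1 h

end Complete

end Beatty

theorem theorem3 (r : ℝ) (hr : 1 < r) (hirr : Irrational r) :
    ∃ ψ : Beatty.FormulaFamily,
      (∀ (n : ℕ) (k : Fin n → ℤ) (I : Finset (Fin n)),
        (ψ n k I).IsQF ∧
          Beatty.Holds (Beatty.BeattyInt r) (Beatty.starSentence k I (ψ n k I))) ∧
      (∀ (M : Type*) [Beatty.LP.Structure M],
        M ≅[Beatty.LP] Beatty.BeattyInt r ↔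
          (@ElementarilyEquivalent Beatty.LGrp M ℤ (Beatty.grpToLP.reduct M) _ ∧
            (∀ (n : ℕ) (k : Fin n → ℤ) (I : Finset (Fin n)),
              Beatty.Holds M (Beatty.starSentence k I (ψ n k I))) ∧
            (∀ k : ℤ, k ∈ Beatty.beattySet r ↔ M ⊨ Beatty.numeralInP k))) ∧
      (Beatty.TrStar r ψ).IsComplete := by
  obtain ⟨ρ, hρ⟩ := Beatty.exists_patternCodes hr hirr
  have hstd := Beatty.holdsAll_beattyInt hr hirr hρ
  exact ⟨Beatty.starFamily ρ, fun n k I => ⟨Beatty.isQF_starFamily ρ n k I, hstd n k I⟩,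
    fun M _ => Beatty.equiv_iff_axioms hstd M, Beatty.isComplete_trStar hr hirr hstd⟩
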